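/- \textbf{Model.} Let $K\ge 1$, let $\lambda_1,\dots,\lambda_K>0$ be reward rates, let $\alpha_0>0$, and for each $m\in\{1,2,\dots\}$ let $\beta_m>0$. In the $m$th system an agent always has a current choice $C^m(t)\in\{1,\dots,K\}$. While $C^m(t)=k$, unit rewards of action $k$ are accrued according to a Poisson process of rate $\lambda_k$. Every reward (including those present at time $0$) departs after an independent exponential lifespan of mean $m$, and $Q^m_k(t)\in\mathbb{Z}_{\ge 0}$ is the number of rewards of action $k$ present at time $t$. At the points $0<S^m_1<S^m_2<\cdots$ of an independent Poisson process of rate $\beta_m$ the agent makes a new choice, equal to $k$ with probability $$\frac{Q^m_k\vee \alpha_0 m}{\sum_{i=1}^K \left(Q^m_i\vee \alpha_0 m\right)},$$ where $Q^m$ is the reward vector at the update point and $x\vee y=\max\{x,y\}$. Put $S^m_0=0$, $Q^m[n]=Q^m(S^m_n)$, $C^m[n]=C^m(S^m_n)$, so that $W^m[n]=(Q^m[n],C^m[n])$, $n\ge 0$, is a discrete-time Markov chain on $\mathbb{Z}_{\ge0}^K\times\{1,\dots,K\}$. \textbf{Proposition.} Assume $\beta_m\ll 1/m$, i.e. $m\beta_m\to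 0$ as $m\to\infty$. For every $m$ the chain $W^m[\cdot]$ has a unique stationary distribution. Let $p^m_k=\mathbb{P}(C^m[\infty]=k)$ be the probability that the choice component equals $k$ under this distribution. Then, for all $k$, $$\lim_{m\to\infty}p^m_k=x^*_k:=\frac{\lambda_k\vee\alpha_0+(K-1)\alpha_0}{z_0},\qquad z_0=\sum_{i=1}^K\left[\lambda_i\vee\alpha_0+(K-1)\alpha_0\right].$$ Moreover, let $q^*_{k,i}=\lambda_k$ if $i=k$ and $q^*_{k,i}=0$ otherwise, and let $$R_{k,i}=\frac{q^*_{k,i}\vee\alpha_0}{\sum_{j=1}^K (q^*_{k,j}\vee\alpha_0)},\qquad 1\le k,i\le K.$$ If $W^m[0]$ has the stationary distribution, then $\lim_{m\to\infty}\mathbb{P}(C^m[1]=i\mid C^m[0]=k)=R_{k,i}$ for all $k,i$. The matrix $R$ is row-stochastic and irreducible, and $x^*$ is its unique stationary probability vector: $x^*$ is a probability vector with $\sum_k x^*_kR_{k,i}=x^*_i$ for all $i$, and it is the only one. -/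

import Mathlib

open MeasureTheory ProbabilityTheory Filter Topology

/-- Parameters of the decision model with `K` actions: reward rates `lam k`, rate of memory
decay `mu`, update rate `beta` and exploration parameter `alpha`, all positive. -/
structure RewardModel (K : ℕ) where
  lam : Fin K → ℝ
  mu : ℝ
  beta : ℝ
  alpha : ℝ
  lam_pos : ∀ k, 0 < lam k
  mu_pos : 0 < mu
  beta_pos : 0 < beta
  alpha_pos : 0 < alpha

/-- A state `(q, c)`: the recallable rewards of every action and the current choice. -/
abbrev RewardState (K : ℕ) : Type := (Fin K → ℕ) × Fin K

/-- A realization of the exogenous randomness, as a tuple `(τ, v, a, l, r)`: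
* `τ n` is the time between the `n`-th and the `(n+1)`-st update point;
* `v n` is the uniform variable used to sample the choice made at the `(n+1)`-st update point;
* `a (k, j)` is the time between consecutive points of the Poisson process of rewards of
  action `k` (the `j`-th gap);
* `l (k, j)` is the lifespan of the reward attached to the `j`-th point of that process;
* `r (k, j)` is the lifespan of the `j`-th reward of action `k` present at time `0`. -/
abbrev Driving (K : ℕ) : Type :=
  (ℕ → ℝ) × (ℕ → unitInterval) × (Fin K × ℕ → ℝ) × (Fin K × ℕ → ℝ) × (Fin K × ℕ → ℝ)

namespace Driving

variable {K : ℕ}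

/-- Gaps between update points. -/
abbrev updateGap (ω : Driving K) (n : ℕ) : ℝ := ω.1 n

/-- Uniform variables used for sampling the choices. -/
abbrev unif (ω : Driving K) (n : ℕ) : ℝ := (ω.2.1 n : ℝ)

/-- Gaps of the Poisson reward processes. -/
abbrev arrivalGap (ω : Driving K) (k : Fin K) (j : ℕ) : ℝ := ω.2.2.1 (k, j)

/-- Lifespans of the rewards accrued after time `0`. -/
abbrev lifespan (ω : Driving K) (k : Fin K) (j : ℕ) : ℝ := ω.2.2.2.1 (k, j)

/-- Lifespans of the rewards present at time `0`. -/
abbrev initialLifespan (ω : Driving K) (k : Fin K) (j : ℕ) : ℝ := ω.2.2.2.2 (k, j)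

/-- The `n`-th update point `S n`, with `S 0 = 0`. -/
noncomputable def updateTime (ω : Driving K) (n : ℕ) : ℝ :=
  ∑ i ∈ Finset.range n, ω.updateGap i

/-- The time of the `j`-th point (`j = 0, 1, …`) of the reward process of action `k`. -/
noncomputable def arrivalTime (ω : Driving K) (k : Fin K) (j : ℕ) : ℝ :=
  ∑ i ∈ Finset.range (j + 1), ω.arrivalGap k i

end Driving

/-- Sampling from the distribution proportional to the positive weights `w`, by inverting its
distribution function at `u ∈ [0, 1]`: the least `k` with
`u * ∑ i, w i ≤ ∑ i ≤ k, w i`. -/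
noncomputable def sampleWeights {K : ℕ} [NeZero K] (w : Fin K → ℝ) (u : ℝ) : Fin K :=
  sInf {k : Fin K | u * ∑ i, w i ≤ ∑ i ∈ Finset.Iic k, w i}

namespace RewardModel

variable {K : ℕ}

/-- The law of the driving randomness: all variables are independent, the gaps between update
points are exponential of rate `beta`, the sampling variables are uniform on `[0, 1]`, the gaps of
the reward process of action `k` are exponential of rate `lam k` (so that this is a Poisson process
of rate `lam k`), and all lifespans are exponential of rate `mu`. -/
noncomputable def drivingLaw (M : RewardModel K) : Measure (Driving K) :=
  haveI : IsProbabilityMeasure (expMeasure M.beta) := isProbabilityMeasure_expMeasure M.beta_pos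
  haveI : IsProbabilityMeasure (expMeasure M.mu) := isProbabilityMeasure_expMeasure M.mu_pos
  haveI : ∀ p : Fin K × ℕ, IsProbabilityMeasure (expMeasure (M.lam p.1)) :=
    fun p => isProbabilityMeasure_expMeasure (M.lam_pos p.1)
  (Measure.infinitePi fun _ : ℕ => expMeasure M.beta).prod <|
    (Measure.infinitePi fun _ : ℕ => (volume : Measure unitInterval)).prod <|
      (Measure.infinitePi fun p : Fin K × ℕ => expMeasure (M.lam p.1)).prod <|
        (Measure.infinitePi fun _ : Fin K × ℕ => expMeasure M.mu).prod <|
          (Measure.infinitePi fun _ : Fin K × ℕ => expMeasure M.mu)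

/-- The recallable rewards of action `k` at time `t`, when there were `q` rewards at time `0` and
action `c n` is in force between the `n`-th and the `(n+1)`-st update point: the number of initial
rewards that are still alive, plus the number of rewards of action `k` that occurred up to time `t`
while action `k` was in force and that are still alive. -/
noncomputable def rewardsUnder (q : Fin K → ℕ) (c : ℕ → Fin K) (ω : Driving K) (t : ℝ)
    (k : Fin K) : ℕ :=
  {j : ℕ | j < q k ∧ t < ω.initialLifespan k j}.ncard +
    {j : ℕ | ω.arrivalTime k j ≤ t ∧ t < ω.arrivalTime k j + ω.lifespan k j ∧
      ∃ n, ω.updateTime n < ω.arrivalTime k j ∧ ω.arrivalTime k j ≤ ω.updateTime (n + 1) ∧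
        c n = k}.ncard

/-- The reward matching rule: the new choice is `k` with probability proportional to
`max (q k) alpha`. -/
noncomputable def newChoice [NeZero K] (M : RewardModel K) (q : Fin K → ℕ) (u : ℝ) : Fin K :=
  sampleWeights (fun k => max (q k : ℝ) M.alpha) u

/-- `M.history x ω n` lists the choices made at the update points `0, …, n` (and repeats the last
one afterwards), when the initial state is `x`. -/
noncomputable def history [NeZero K] (M : RewardModel K) (x : RewardState K) (ω : Driving K) :
    ℕ → ℕ → Fin K
  | 0 => fun _ => x.2
  | n + 1 => fun j =>
      if j ≤ n then M.history x ω n j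
      else M.newChoice (rewardsUnder x.1 (M.history x ω n) ω (ω.updateTime (n + 1))) (ω.unif n)

/-- The choice made at the `n`-th update point (the initial choice if `n = 0`). -/
noncomputable def choiceMade [NeZero K] (M : RewardModel K) (x : RewardState K) (ω : Driving K)
    (n : ℕ) : Fin K :=
  M.history x ω n n

/-- The recallable reward process `Q(t)` started from the state `x`. -/
noncomputable def rewardAt [NeZero K] (M : RewardModel K) (x : RewardState K)
    (ω : Driving K) (t : ℝ) : Fin K → ℕ :=
  rewardsUnder x.1 (M.choiceMade x ω) ω t

/-- The choice process `C(t)` started from the state `x`: the choice made at the last update point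
up to time `t`. -/
noncomputable def choiceAt [NeZero K] (M : RewardModel K) (x : RewardState K)
    (ω : Driving K) (t : ℝ) : Fin K :=
  M.choiceMade x ω (sSup {n : ℕ | ω.updateTime n ≤ t})

/-- The joint process `W(t) = (Q(t), C(t))`. -/
noncomputable def jointAt [NeZero K] (M : RewardModel K) (x : RewardState K)
    (ω : Driving K) (t : ℝ) : RewardState K :=
  (M.rewardAt x ω t, M.choiceAt x ω t)

/-- The embedded discrete-time chain `W[n] = (Q[n], C[n]) = W(S n)`. -/
noncomputable def embedded [NeZero K] (M : RewardModel K) (x : RewardState K)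
    (ω : Driving K) (n : ℕ) : RewardState K :=
  M.jointAt x ω (ω.updateTime n)

/-- The law of initial state and driving randomness, when the initial state has law `π` and is
independent of the driving randomness. -/
noncomputable def startedFrom (M : RewardModel K) (π : Measure (RewardState K)) :
    Measure (RewardState K × Driving K) :=
  π.prod M.drivingLaw

/-- `π` is a stationary distribution of the embedded Markov chain `W[·]`: it is a probability
measure, and if `W[0]` starts from `π` then one step later `W[1]` has law `π` again. -/
structure IsStationary [NeZero K] (M : RewardModel K) (π : Measure (RewardState K)) : Prop where
  isProbabilityMeasure : IsProbabilityMeasure π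
  map_eq : (M.startedFrom π).map (fun p => M.embedded p.1 p.2 1) = π

/-- The probability that `C[1] = i` given `C[0] = k`, when the initial state has law `π`. -/
noncomputable def choiceTransition [NeZero K] (M : RewardModel K) (π : Measure (RewardState K))
    (k i : Fin K) : ℝ :=
  (ProbabilityTheory.cond (M.startedFrom π) {p | (M.embedded p.1 p.2 0).2 = k}).real
    {p | (M.embedded p.1 p.2 1).2 = i}

/-- The `m`-th system of the scaled sequence: mean lifespan `m`, that is `mu = 1 / m`, exploration
parameter `alpha0 * m`, and update rate `beta m`. -/
noncomputable def scaled (lam : Fin K → ℝ) (hlam : ∀ k, 0 < lam k) (alpha0 : ℝ)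
    (halpha : 0 < alpha0) (beta : ℕ+ → ℝ) (hbeta : ∀ m, 0 < beta m) (m : ℕ+) :
    RewardModel K where
  lam := lam
  mu := 1 / (m : ℝ)
  beta := beta m
  alpha := alpha0 * (m : ℝ)
  lam_pos := hlam
  mu_pos := one_div_pos.mpr (Nat.cast_pos.mpr m.pos)
  beta_pos := hbeta m
  alpha_pos := mul_pos halpha (Nat.cast_pos.mpr m.pos)

end RewardModel

/-- The limiting chain on the `K` actions: from action `k` it moves to action `i` with probability
proportional to `max (q k i) alpha0`, where `q k i` is `lam k` if `i = k` and `0` otherwise. -/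
noncomputable def limitChain {K : ℕ} (lam : Fin K → ℝ) (alpha0 : ℝ) :
    Matrix (Fin K) (Fin K) ℝ :=
  Matrix.of fun k i =>
    max (if k = i then lam k else 0) alpha0 / ∑ j, max (if k = j then lam k else 0) alpha0

/-- The vector `(max (lam k) alpha0 + (K - 1) alpha0) / z0`. -/
noncomputable def limitProb {K : ℕ} (lam : Fin K → ℝ) (alpha0 : ℝ) (k : Fin K) : ℝ :=
  (max (lam k) alpha0 + ((K : ℝ) - 1) * alpha0) /
    ∑ i, (max (lam i) alpha0 + ((K : ℝ) - 1) * alpha0)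

/-!
In every period the chain restarts almost from scratch: when `m * beta m → 0` the update periods
are much longer than the lifespans, so the rewards present at an update point are close to those
which the current choice `k` alone would yield in the long run, namely `lam k * m` of action `k`
and none of the other actions. The next choice is then sampled nearly according to row `k` of the
limiting matrix `R`, so the stationary choice probabilities `p` satisfy `p R ≈ p`, and they
converge because the equation `p R = p` is well conditioned on probability vectors.

Everything depends only on the transition kernel of one step, `RewardModel.stepKernel`, in which
the rewards at the first update point are the surviving initial rewards plus the accrued rewards
of the current choice (`RewardModel.embedded_one_eq_step`).

*Existence and uniqueness.* From every state the empty state with choice `0` is reached in one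
step with positive probability (`RewardModel.stepKernel_empty_ne_zero`), which gives uniqueness
(`MarkovChain.invariant_unique`). The total number of rewards has a geometric drift, with factor
`β / (β + μ)`, the probability that a reward outlives an update period. As its sublevel sets are
finite, the empty state has a finite mean return time, and the occupation measure of an excursion
from it is invariant (`MarkovChain.exists_invariant_of_drift`). The drift also bounds the mean
number of rewards in stationarity (`MarkovChain.lintegral_le_of_drift`).

*The accrued rewards.* The number of points of a Poisson process still alive at time `t` is a sum
of indicators. Its mean is computed, and its second moment bounded, from the first and second
order Campbell formulas (`PoissonProcess.tsum_lintegral_arrival`,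
`PoissonProcess.tsum_tsum_lintegral_arrival_le`), which follow from the renewal equation of the
exponential law (`PoissonProcess.lintegral_expMeasure_add_tailMean`). Hence the number of accrued
rewards is close to `lam k / mu` in mean (`RewardModel.integral_abs_accrued_sub_le`).

*The limit.* The matching probabilities are Lipschitz in the rewards with constant `2 / alpha`
(`abs_matchProb_sub_le`), so the joint law of two consecutive choices in stationarity differs from
`p k * R k i` by a quantity which vanishes in the limit (`RewardModel.tendsto_jointChoice_sub`).
The equations `p - p R = e` are solved explicitly for `p` (`eq_limitProb_add`); `e = 0` gives the
uniqueness of the stationary vector of `R`, and `e → 0` gives the convergence.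
-/

open scoped ENNReal

/-! ### Invariant measures of Markov kernels with an accessible state -/

namespace MarkovChain

variable {S : Type*} [MeasurableSpace S]

/-- If every state reaches `y₀` in one step with positive probability, there is at most one
invariant probability measure: the pointwise minimum `m` of the weights of two of them is invariant,
hence, by looking at `y₀`, equal to one of the two. -/
theorem invariant_unique [Countable S] [MeasurableSingletonClass S] (κ : Kernel S S)
    [IsMarkovKernel κ] {y₀ : S} (hy₀ : ∀ x, κ x {y₀} ≠ 0) {π π' : Measure S}
    [IsProbabilityMeasure π] [IsProbabilityMeasure π']
    (hπ : κ.Invariant π) (hπ' : κ.Invariant π') : π = π' := by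
  wlog hle : π {y₀} ≤ π' {y₀} generalizing π π' with H
  · exact (H hπ' hπ (not_le.mp hle).le).symm
  have hsum : ∀ ν : Measure S, IsProbabilityMeasure ν → ∑' x, ν {x} = 1 := by
    intro ν hν
    rw [← measure_univ (μ := ν), ← Measure.tsum_indicator_apply_singleton ν _ MeasurableSet.univ]
    simp
  have hbal : ∀ ν : Measure S, κ.Invariant ν → ∀ y, ∑' x, ν {x} * κ x {y} = ν {y} := by
    intro ν hν y
    conv_rhs => rw [← hν.def]
    rw [Measure.bind_apply (measurableSet_singleton y) κ.measurable.aemeasurable,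
      lintegral_countable']
    exact tsum_congr fun x => mul_comm _ _
  have hκ : ∀ x, ∑' y, κ x {y} = 1 := fun x => hsum _ inferInstance
  set m : S → ℝ≥0∞ := fun x => min (π {x}) (π' {x})
  have hmsub : ∀ y, ∑' x, m x * κ x {y} ≤ m y := by
    intro y
    refine le_min ?_ ?_
    · rw [← hbal π hπ y]
      exact ENNReal.tsum_le_tsum fun x => by gcongr; exact min_le_left _ _
    · rw [← hbal π' hπ' y]
      exact ENNReal.tsum_le_tsum fun x => by gcongr; exact min_le_right _ _
  have hmtot : ∑' y, ∑' x, m x * κ x {y} = ∑' y, m y := by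
    rw [ENNReal.tsum_comm]
    simp_rw [ENNReal.tsum_mul_left, hκ, mul_one]
  have hmfin : ∑' y, m y ≠ ∞ := by
    refine ne_top_of_le_ne_top ENNReal.one_ne_top ?_
    rw [← hsum π inferInstance]
    exact ENNReal.tsum_le_tsum fun x => min_le_left _ _
  have hmeq : ∑' x, m x * κ x {y₀} = π {y₀} := by
    have h1 : m y₀ = π {y₀} := min_eq_left hle
    rw [← h1]
    by_contra hne
    exact absurd hmtot (ENNReal.tsum_lt_tsum (hmtot ▸ hmfin) hmsub
      (lt_of_le_of_ne (hmsub y₀) hne)).ne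
  have hall : ∀ x, m x = π {x} := by
    intro x
    by_contra hne
    have hlt : m x < π {x} := lt_of_le_of_ne (min_le_left _ _) hne
    have := ENNReal.tsum_lt_tsum (f := fun x => m x * κ x {y₀}) (g := fun x => π {x} * κ x {y₀})
      (i := x) (by rw [hmeq]; exact measure_ne_top _ _)
      (fun z => by gcongr; exact min_le_left _ _)
      (by
        rw [mul_comm, mul_comm (π {x})]
        exact ENNReal.mul_lt_mul_right (hy₀ x) (measure_ne_top _ _) hlt)
    rw [hmeq, hbal π hπ] at this
    exact this.false
  have hfin : ∀ x, π {x} ≤ π' {x} := fun x => by rw [← hall x]; exact min_le_right _ _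
  refine Measure.ext_of_singleton fun x => ?_
  by_contra hne
  have := ENNReal.tsum_lt_tsum (f := fun x => π {x}) (g := fun x => π' {x}) (i := x)
    (by rw [hsum π inferInstance]; exact ENNReal.one_ne_top) hfin (lt_of_le_of_ne (hfin x) hne)
  rw [hsum π inferInstance, hsum π' inferInstance] at this
  exact this.false

/-- If the expected number of steps to reach `y₀` is finite, as witnessed by a finite function `W`
that decreases by at least `1` on average while `y₀` is avoided, then there is an invariant
probability measure: the normalized occupation measure of an excursion from `y₀`. -/
theorem exists_invariant_of_hitting [MeasurableSingletonClass S] (κ : Kernel S S)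
    [IsMarkovKernel κ] {y₀ : S} {W : S → ℝ≥0∞} (hW : Measurable W) (hW₀ : W y₀ ≠ ∞)
    (hdrift : ∀ x, ∫⁻ y in {y₀}ᶜ, W y ∂(κ x) + 1 ≤ W x) :
    ∃ π : Measure S, IsProbabilityMeasure π ∧ κ.Invariant π := by
  -- `u n` is the law of the chain after `n` steps, on the event that it has not returned to `y₀`.
  let u : ℕ → Measure S := fun n =>
    Nat.rec (Measure.dirac y₀) (fun _ ν => (ν.bind κ).restrict {y₀}ᶜ) n
  have hu0 : u 0 = Measure.dirac y₀ := rfl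
  have hus : ∀ n, u (n + 1) = ((u n).bind κ).restrict {y₀}ᶜ := fun n => rfl
  have hstep : ∀ n, ∫⁻ y, W y ∂(u (n + 1)) + u n Set.univ ≤ ∫⁻ y, W y ∂(u n) := by
    intro n
    have h1 : ∫⁻ y, W y ∂(u (n + 1)) = ∫⁻ x, ∫⁻ y in {y₀}ᶜ, W y ∂(κ x) ∂(u n) := by
      rw [hus, ← lintegral_indicator (measurableSet_singleton y₀).compl,
        Measure.lintegral_bind κ.measurable.aemeasurable
          (hW.indicator (measurableSet_singleton y₀).compl).aemeasurable]
      simp_rw [lintegral_indicator (measurableSet_singleton y₀).compl]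
    rw [h1, ← lintegral_one, ← lintegral_add_right _ measurable_const]
    exact lintegral_mono hdrift
  have hpart : ∀ N, ∑ n ∈ Finset.range N, u n Set.univ + ∫⁻ y, W y ∂(u N) ≤ W y₀ := by
    intro N
    induction N with
    | zero => simp [hu0, lintegral_dirac]
    | succ N ih =>
      refine le_trans ?_ ih
      rw [Finset.sum_range_succ, add_assoc]
      gcongr
      rw [add_comm]
      exact hstep N
  set U : Measure S := Measure.sum u with hU
  have hUfin : U Set.univ ≠ ∞ := by
    refine ne_top_of_le_ne_top hW₀ ?_
    rw [hU, Measure.sum_apply _ MeasurableSet.univ]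
    exact ENNReal.tsum_le_of_sum_range_le fun N => le_self_add.trans (hpart N)
  have hUsplit : U = Measure.dirac y₀ + (U.bind κ).restrict {y₀}ᶜ := by
    have h1 : U = u 0 + Measure.sum fun n => u (n + 1) := by
      refine Measure.ext fun s hs => ?_
      rw [Measure.add_apply, Measure.sum_apply _ hs, Measure.sum_apply _ hs]
      exact tsum_eq_zero_add' ENNReal.summable
    conv_lhs => rw [h1]
    rw [hu0]
    congr 1
    rw [hU, Measure.bind_sum _ _ κ.measurable.aemeasurable,
      Measure.restrict_sum _ (measurableSet_singleton y₀).compl]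
  have hmass : (U.bind κ) Set.univ = U Set.univ := by
    rw [Measure.bind_apply MeasurableSet.univ κ.measurable.aemeasurable]
    simp
  have hone : (U.bind κ) {y₀} = 1 := by
    have h1 : U Set.univ = 1 + (U.bind κ) {y₀}ᶜ := by
      conv_lhs => rw [hUsplit]
      simp
    have h2 : (U.bind κ) {y₀} + (U.bind κ) {y₀}ᶜ = 1 + (U.bind κ) {y₀}ᶜ := by
      rw [measure_add_measure_compl (measurableSet_singleton y₀), hmass, h1]
    refine (ENNReal.add_left_inj ?_).mp h2
    exact ne_top_of_le_ne_top (hmass ▸ hUfin) (measure_mono (Set.subset_univ _))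
  have hinv : U.bind κ = U := by
    conv_rhs => rw [hUsplit]
    conv_lhs =>
      rw [← Measure.restrict_add_restrict_compl (μ := U.bind κ) (measurableSet_singleton y₀),
        Measure.restrict_singleton, hone, one_smul]
  have hU0 : U Set.univ ≠ 0 := by
    rw [hUsplit]; simp
  refine ⟨(U Set.univ)⁻¹ • U, ⟨?_⟩, ?_⟩
  · rw [Measure.smul_apply, smul_eq_mul, ENNReal.inv_mul_cancel hU0 hUfin]
  · unfold Kernel.Invariant
    rw [Measure.bind_smul, hinv]

/-- Foster's criterion with a geometric drift towards the sublevel sets of `V`, which are finite. -/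
theorem exists_invariant_of_drift [MeasurableSingletonClass S] (κ : Kernel S S)
    [IsMarkovKernel κ] {y₀ : S} (hy₀ : ∀ x, κ x {y₀} ≠ 0) {V : S → ℕ}
    (hV : Measurable V) (hfin : ∀ R : ℕ, {x | V x ≤ R}.Finite) {ρ C : ℝ≥0∞} (hρ : ρ < 1)
    (hC : C ≠ ∞) (hdrift : ∀ x, ∫⁻ y, V y ∂(κ x) ≤ ρ * V x + C) :
    ∃ π : Measure S, IsProbabilityMeasure π ∧ κ.Invariant π := by
  have hρ0 : 1 - ρ ≠ 0 := (tsub_pos_of_lt hρ).ne'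
  obtain ⟨R, hR⟩ : ∃ R : ℕ, (C + 1) / (1 - ρ) ≤ R := by
    obtain ⟨R, hR⟩ := ENNReal.exists_nat_gt (r := (C + 1) / (1 - ρ))
      (ENNReal.div_ne_top (by simp [hC]) hρ0)
    exact ⟨R, hR.le⟩
  -- On the finite set `{V ≤ R}` the chance to jump to `y₀` pays for the constant `C + 1`.
  set a : ℝ≥0∞ := ∑ x ∈ (hfin R).toFinset, (C + 1) / κ x {y₀} with ha
  have hafin : a ≠ ∞ := ENNReal.sum_ne_top.mpr fun x _ =>
    ENNReal.div_ne_top (by simp [hC]) (hy₀ x)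
  have hVm : Measurable fun x => (V x : ℝ≥0∞) :=
    (measurable_from_top (f := fun n : ℕ => (n : ℝ≥0∞))).comp hV
  refine exists_invariant_of_hitting κ (y₀ := y₀) (W := fun x => a + V x)
    (measurable_const.add hVm) (by simp [hafin]) fun x => ?_
  have h1 : ∫⁻ y in {y₀}ᶜ, (a + V y) ∂(κ x) ≤ a * κ x {y₀}ᶜ + (ρ * V x + C) := by
    rw [lintegral_add_left measurable_const, setLIntegral_const]
    gcongr
    exact (setLIntegral_le_lintegral _ _).trans (hdrift x)
  have h2 : a * κ x {y₀} + a * κ x {y₀}ᶜ = a := by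
    rw [← mul_add, measure_add_measure_compl (measurableSet_singleton y₀), measure_univ, mul_one]
  have h3 : ρ * V x + (1 - ρ) * V x = V x := by
    rw [← add_mul, add_tsub_cancel_of_le hρ.le, one_mul]
  have h4 : C + 1 ≤ a * κ x {y₀} + (1 - ρ) * V x := by
    by_cases hx : V x ≤ R
    · refine le_trans ?_ le_self_add
      have : (C + 1) / κ x {y₀} ≤ a :=
        Finset.single_le_sum (f := fun x => (C + 1) / κ x {y₀}) (fun _ _ => zero_le)
          ((hfin R).mem_toFinset.mpr hx)
      calc C + 1 = (C + 1) / κ x {y₀} * κ x {y₀} :=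
            (ENNReal.div_mul_cancel (hy₀ x) (measure_ne_top _ _)).symm
        _ ≤ _ := by gcongr
    · refine le_trans ?_ le_add_self
      have h5 : (C + 1) / (1 - ρ) ≤ V x := hR.trans (by exact_mod_cast (not_le.mp hx).le)
      rw [mul_comm]
      exact (ENNReal.div_le_iff hρ0 (ne_top_of_le_ne_top ENNReal.one_ne_top tsub_le_self)).mp h5
  calc ∫⁻ y in {y₀}ᶜ, (a + V y) ∂(κ x) + 1 ≤ a * κ x {y₀}ᶜ + (ρ * V x + C) + 1 := by gcongr
    _ = a * κ x {y₀}ᶜ + ρ * V x + (C + 1) := by ring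
    _ ≤ a * κ x {y₀}ᶜ + ρ * V x + (a * κ x {y₀} + (1 - ρ) * V x) := by gcongr
    _ = (a * κ x {y₀} + a * κ x {y₀}ᶜ) + (ρ * V x + (1 - ρ) * V x) := by ring
    _ = a + V x := by rw [h2, h3]

/-- A geometric drift bounds the mean of `V` under every invariant probability measure. As this mean
is not known to be finite beforehand, the drift is applied to the truncations `min V M`, which gives
`E (min V M) ≤ C + ρ * E (min V (M / ρ))`, and the inequality is iterated. -/
theorem lintegral_le_of_drift {κ : Kernel S S} [IsMarkovKernel κ] {π : Measure S}
    [IsProbabilityMeasure π] (hπ : κ.Invariant π) {V : S → ℝ≥0∞} (hV : Measurable V)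
    (hVfin : ∀ x, V x ≠ ∞) {ρ C : ℝ≥0∞} (hρ : ρ < 1)
    (hdrift : ∀ x, ∫⁻ y, V y ∂(κ x) ≤ ρ * V x + C) :
    ∫⁻ x, V x ∂π ≤ C / (1 - ρ) := by
  -- `g n M` is the mean of `min (ρ ^ n * V) M`.
  set g : ℕ → ℕ → ℝ≥0∞ := fun n M => ∫⁻ x, min (ρ ^ n * V x) M ∂π with hg
  have hgs : ∀ n M, g n M ≤ g (n + 1) M + ρ ^ n * C := by
    intro n M
    have hmeas : Measurable fun x => min (ρ ^ n * V x) (M : ℝ≥0∞) := by fun_prop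
    calc g n M = ∫⁻ x, min (ρ ^ n * V x) M ∂(π.bind κ) := by rw [hπ.def]
      _ = ∫⁻ x, ∫⁻ y, min (ρ ^ n * V y) M ∂(κ x) ∂π :=
          Measure.lintegral_bind κ.measurable.aemeasurable hmeas.aemeasurable
      _ ≤ ∫⁻ x, (min (ρ ^ (n + 1) * V x) M + ρ ^ n * C) ∂π := by
          refine lintegral_mono fun x => ?_
          have h1 : ∫⁻ y, min (ρ ^ n * V y) (M : ℝ≥0∞) ∂(κ x) ≤ ρ ^ (n + 1) * V x + ρ ^ n * C := by
            calc ∫⁻ y, min (ρ ^ n * V y) (M : ℝ≥0∞) ∂(κ x) ≤ ∫⁻ y, ρ ^ n * V y ∂(κ x) :=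
                  lintegral_mono fun y => min_le_left _ _
              _ = ρ ^ n * ∫⁻ y, V y ∂(κ x) := lintegral_const_mul _ hV
              _ ≤ ρ ^ n * (ρ * V x + C) := by gcongr; exact hdrift x
              _ = _ := by ring
          have h2 : ∫⁻ y, min (ρ ^ n * V y) (M : ℝ≥0∞) ∂(κ x) ≤ M := by
            calc _ ≤ ∫⁻ y, (M : ℝ≥0∞) ∂(κ x) := lintegral_mono fun y => min_le_right _ _
              _ = M := by simp
          rw [min_add]
          exact le_min h1 (h2.trans le_self_add)
      _ = _ := by rw [lintegral_add_right _ measurable_const]; simp [hg]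
  have hgn : ∀ n M, g 0 M ≤ g n M + ∑ i ∈ Finset.range n, ρ ^ i * C := by
    intro n M
    induction n with
    | zero => simp
    | succ n ih =>
      rw [Finset.sum_range_succ, add_comm (Finset.sum _ _), ← add_assoc]
      refine ih.trans ?_
      gcongr
      exact hgs n M
  have hgeo : ∑' i, ρ ^ i * C = C / (1 - ρ) := by
    rw [ENNReal.tsum_mul_right, ENNReal.tsum_geometric, mul_comm, div_eq_mul_inv]
  have hlim : ∀ M : ℕ, Tendsto (fun n => g n M) atTop (𝓝 0) := by
    intro M
    have := tendsto_lintegral_of_dominated_convergence (μ := π)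
      (F := fun n x => min (ρ ^ n * V x) (M : ℝ≥0∞)) (f := fun _ => 0) (fun _ => (M : ℝ≥0∞))
      (fun n => by fun_prop) (fun n => Eventually.of_forall fun x => min_le_right _ _)
      (by simp) (Eventually.of_forall fun x => by
        have h1 : Tendsto (fun n : ℕ => ρ ^ n * V x) atTop (𝓝 (0 * V x)) :=
          ENNReal.Tendsto.mul_const (ENNReal.tendsto_pow_atTop_nhds_zero_of_lt_one hρ)
            (Or.inr (hVfin x))
        rw [zero_mul] at h1
        exact tendsto_of_tendsto_of_tendsto_of_le_of_le tendsto_const_nhds h1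
          (fun _ => zero_le) fun _ => min_le_left _ _)
    simpa using this
  have hg0 : ∀ M, g 0 M ≤ C / (1 - ρ) := by
    intro M
    have h1 : Tendsto (fun n => g n M + C / (1 - ρ)) atTop (𝓝 (0 + C / (1 - ρ))) :=
      (hlim M).add tendsto_const_nhds
    rw [zero_add] at h1
    refine ge_of_tendsto h1 (Eventually.of_forall fun n => (hgn n M).trans ?_)
    gcongr
    rw [← hgeo]
    exact ENNReal.sum_le_tsum _
  have hsup : ∀ x, V x = ⨆ M : ℕ, min (ρ ^ 0 * V x) (M : ℝ≥0∞) := by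
    intro x
    rw [pow_zero, one_mul]
    refine le_antisymm ?_ (iSup_le fun M => min_le_left _ _)
    obtain ⟨M, hM⟩ := ENNReal.exists_nat_gt (hVfin x)
    exact le_iSup_of_le M (le_min le_rfl hM.le)
  rw [lintegral_congr hsup, lintegral_iSup (f := fun (M : ℕ) x => min (ρ ^ 0 * V x) (M : ℝ≥0∞))
    (fun M => by fun_prop) (fun M N h x => min_le_min_left _ (by exact_mod_cast h))]
  exact iSup_le hg0

end MarkovChain

/-! ### The exponential distribution -/

namespace ProbabilityTheory

theorem expMeasure_eq_withDensity (r : ℝ) :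
    expMeasure r = (volume : Measure ℝ).withDensity (exponentialPDF r) := rfl

theorem measurable_exponentialPDF (r : ℝ) : Measurable (exponentialPDF r) :=
  (measurable_exponentialPDFReal r).ennreal_ofReal

theorem lintegral_expMeasure (r : ℝ) {f : ℝ → ℝ≥0∞} (hf : Measurable f) :
    ∫⁻ x, f x ∂(expMeasure r) = ∫⁻ x, exponentialPDF r x * f x := by
  rw [expMeasure_eq_withDensity, lintegral_withDensity_eq_lintegral_mul _
    (measurable_exponentialPDF r) hf]
  rfl

theorem expMeasure_Iic {r : ℝ} (hr : 0 < r) (x : ℝ) :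
    expMeasure r (Set.Iic x) = ENNReal.ofReal (if 0 ≤ x then 1 - Real.exp (-(r * x)) else 0) := by
  rw [expMeasure_eq_withDensity, withDensity_apply _ measurableSet_Iic,
    lintegral_exponentialPDF_eq_antiDeriv hr]

theorem expMeasure_Ioi {r : ℝ} (hr : 0 < r) {x : ℝ} (hx : 0 ≤ x) :
    expMeasure r (Set.Ioi x) = ENNReal.ofReal (Real.exp (-(r * x))) := by
  have := isProbabilityMeasure_expMeasure hr
  have hle : Real.exp (-(r * x)) ≤ 1 := Real.exp_le_one_iff.mpr (by nlinarith)
  rw [← Set.compl_Iic, prob_compl_eq_one_sub measurableSet_Iic, expMeasure_Iic hr, if_pos hx,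
    ← ENNReal.ofReal_one, ← ENNReal.ofReal_sub _ (by linarith)]
  congr 1; ring

theorem expMeasure_Iic_zero {r : ℝ} (hr : 0 < r) : expMeasure r (Set.Iic 0) = 0 := by
  rw [expMeasure_Iic hr]; simp

theorem ae_pos_expMeasure {r : ℝ} (hr : 0 < r) : ∀ᵐ x ∂(expMeasure r), 0 < x := by
  have h : {x : ℝ | ¬0 < x} = Set.Iic 0 := by ext x; simp
  rw [ae_iff, h, expMeasure_Iic_zero hr]

theorem expMeasure_Ioi_pos {r : ℝ} (hr : 0 < r) {x : ℝ} (hx : 0 ≤ x) :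
    0 < expMeasure r (Set.Ioi x) := by
  rw [expMeasure_Ioi hr hx]; exact ENNReal.ofReal_pos.mpr (Real.exp_pos _)

theorem expMeasure_Iic_pos {r : ℝ} (hr : 0 < r) {x : ℝ} (hx : 0 < x) :
    0 < expMeasure r (Set.Iic x) := by
  rw [expMeasure_Iic hr, if_pos hx.le, ENNReal.ofReal_pos, sub_pos, Real.exp_lt_one_iff]
  nlinarith

/-- The Laplace transform of the exponential distribution. -/
theorem lintegral_exp_neg_expMeasure {β μ : ℝ} (hβ : 0 < β) (hμ : 0 < μ) :
    ∫⁻ t, ENNReal.ofReal (Real.exp (-(μ * t))) ∂(expMeasure β) =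
      ENNReal.ofReal (β / (β + μ)) := by
  rw [lintegral_expMeasure _ (by fun_prop)]
  have h : ∀ t, exponentialPDF β t * ENNReal.ofReal (Real.exp (-(μ * t))) =
      ENNReal.ofReal (β / (β + μ)) * exponentialPDF (β + μ) t := by
    intro t
    rw [exponentialPDF_eq, exponentialPDF_eq]
    split_ifs
    · rw [← ENNReal.ofReal_mul (by positivity), ← ENNReal.ofReal_mul (by positivity), mul_assoc,
        ← Real.exp_add]
      congr 1
      rw [show -(β * t) + -(μ * t) = -((β + μ) * t) by ring]
      field_simp
    · simp
  simp_rw [h]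
  rw [lintegral_const_mul _ (measurable_exponentialPDF _), lintegral_exponentialPDF_eq_one
    (by positivity), mul_one]

theorem expMeasure_Ioi_eq_pdf {μ : ℝ} (hμ : 0 < μ) {x : ℝ} (hx : 0 ≤ x) :
    expMeasure μ (Set.Ioi x) = (ENNReal.ofReal μ)⁻¹ * exponentialPDF μ x := by
  rw [expMeasure_Ioi hμ hx, exponentialPDF_of_nonneg hx, ENNReal.ofReal_mul hμ.le, ← mul_assoc,
    ENNReal.inv_mul_cancel (by simpa using hμ) ENNReal.ofReal_ne_top, one_mul]

end ProbabilityTheory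

/-! ### Renewal identities for the Poisson process -/

namespace PoissonProcess

/-- Prepending a term to a sequence. -/
def seqCons (x : ℝ) (a : ℕ → ℝ) : ℕ → ℝ
  | 0 => x
  | n + 1 => a n

/-- The `n`-th point (`n = 0, 1, …`) of the point process on the half-line with gaps `a`. -/
noncomputable def arrival (a : ℕ → ℝ) (n : ℕ) : ℝ := ∑ i ∈ Finset.range (n + 1), a i

theorem measurable_arrival (n : ℕ) : Measurable fun a => arrival a n := by
  unfold arrival; fun_prop

theorem arrival_seqCons_zero (x : ℝ) (a : ℕ → ℝ) : arrival (seqCons x a) 0 = x := by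
  simp [arrival, seqCons]

theorem arrival_seqCons_succ (x : ℝ) (a : ℕ → ℝ) (n : ℕ) :
    arrival (seqCons x a) (n + 1) = x + arrival a n := by
  unfold arrival
  rw [Finset.sum_range_succ', add_comm]
  rfl

theorem measurable_seqCons : Measurable fun p : ℝ × (ℕ → ℝ) => seqCons p.1 p.2 := by
  refine measurable_pi_lambda _ fun n => ?_
  cases n with
  | zero => exact measurable_fst
  | succ n => exact (measurable_pi_apply n).comp measurable_snd

variable {P : Measure ℝ} [IsProbabilityMeasure P]

/-- An i.i.d. sequence with an independent term of the same law prepended is i.i.d. -/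
theorem map_seqCons :
    (P.prod (Measure.infinitePi fun _ : ℕ => P)).map (fun p => seqCons p.1 p.2) =
      Measure.infinitePi fun _ : ℕ => P := by
  classical
  refine Measure.eq_infinitePi _ fun s t ht => ?_
  have hpre : (fun p : ℝ × (ℕ → ℝ) => seqCons p.1 p.2) ⁻¹' (Set.pi s t) =
      (if 0 ∈ s then t 0 else Set.univ) ×ˢ
        Set.pi (s.preimage Nat.succ Nat.succ_injective.injOn) fun n => t (n + 1) := by
    ext ⟨x, a⟩
    simp only [Set.mem_preimage, Set.mem_pi, Set.mem_prod, Finset.coe_preimage,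
      Finset.mem_coe]
    constructor
    · intro h
      refine ⟨?_, fun n hn => h (n + 1) hn⟩
      split_ifs with h0
      · exact h 0 h0
      · trivial
    · rintro ⟨h0, h1⟩ n hn
      cases n with
      | zero => rw [if_pos hn] at h0; exact h0
      | succ n => exact h1 n hn
  rw [Measure.map_apply measurable_seqCons
    (MeasurableSet.pi s.countable_toSet fun i _ => ht i), hpre, Measure.prod_prod,
    Measure.infinitePi_pi _ fun i _ => ht (i + 1), Finset.prod_preimage' Nat.succ s
      Nat.succ_injective.injOn (fun n => P (t n))]
  have hfilter : s.filter (fun n => n ∈ Set.range Nat.succ) = s.erase 0 := by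
    ext n
    rw [Finset.mem_filter, Finset.mem_erase, and_comm]
    cases n <;> simp
  rw [hfilter]
  split_ifs with h0
  · exact Finset.mul_prod_erase s (fun n => P (t n)) h0
  · rw [measure_univ, one_mul, Finset.erase_eq_of_notMem h0]

theorem lintegral_infinitePi_eq_seqCons {Φ : (ℕ → ℝ) → ℝ≥0∞} (hΦ : Measurable Φ) :
    ∫⁻ a, Φ a ∂(Measure.infinitePi fun _ : ℕ => P) =
      ∫⁻ x, ∫⁻ a, Φ (seqCons x a) ∂(Measure.infinitePi fun _ : ℕ => P) ∂P := by
  conv_lhs => rw [← map_seqCons (P := P), lintegral_map hΦ measurable_seqCons]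
  exact lintegral_prod _ (hΦ.comp measurable_seqCons).aemeasurable

/-- The mean of the sum of `f` over the points beyond `x` of a Poisson process of rate `r` on the
line. -/
noncomputable def tailMean (r : ℝ) (f : ℝ → ℝ≥0∞) (x : ℝ) : ℝ≥0∞ :=
  ENNReal.ofReal r * ∫⁻ w in Set.Ici x, f w

theorem tailMean_eq_indicator (r : ℝ) (f : ℝ → ℝ≥0∞) (x : ℝ) :
    tailMean r f x = ENNReal.ofReal r * ∫⁻ w, (Set.Ici x).indicator f w := by
  rw [tailMean, lintegral_indicator measurableSet_Ici]

theorem measurable_tailMean (r : ℝ) {f : ℝ → ℝ≥0∞} (hf : Measurable f) :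
    Measurable (tailMean r f) := by
  simp_rw [funext (tailMean_eq_indicator r f)]
  refine Measurable.const_mul ?_ _
  refine Measurable.lintegral_prod_right' (f := fun p : ℝ × ℝ => (Set.Ici p.1).indicator f p.2) ?_
  have : (fun p : ℝ × ℝ => (Set.Ici p.1).indicator f p.2) =
      {p : ℝ × ℝ | p.1 ≤ p.2}.indicator fun p => f p.2 := by
    ext p; simp [Set.indicator]
  rw [this]
  exact (hf.comp measurable_snd).indicator (measurableSet_le measurable_fst measurable_snd)

theorem tailMean_comp_add (r : ℝ) (f : ℝ → ℝ≥0∞) (x y : ℝ) :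
    tailMean r (fun w => f (x + w)) y = tailMean r f (x + y) := by
  rw [tailMean_eq_indicator, tailMean_eq_indicator]
  congr 1
  rw [← lintegral_add_left_eq_self (fun w => (Set.Ici (x + y)).indicator f w) x]
  refine lintegral_congr fun w => ?_
  simp [Set.indicator]

variable {r : ℝ}

/-- The renewal equation: Lebesgue measure of density `r` on the half-line is the exponential law
plus its own convolution with the exponential law. -/
theorem lintegral_expMeasure_add_tailMean (hr : 0 < r) {f : ℝ → ℝ≥0∞} (hf : Measurable f) :
    ∫⁻ s, f s ∂(expMeasure r) + ∫⁻ s, tailMean r f s ∂(expMeasure r) = tailMean r f 0 := by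
  have := isProbabilityMeasure_expMeasure hr
  have h1 : ∫⁻ s, tailMean r f s ∂(expMeasure r) =
      ∫⁻ w, ENNReal.ofReal r * f w * expMeasure r (Set.Iic w) := by
    simp_rw [tailMean_eq_indicator]
    have hm : Measurable (fun p : ℝ × ℝ => (Set.Ici p.1).indicator f p.2) := by
      have : (fun p : ℝ × ℝ => (Set.Ici p.1).indicator f p.2) =
          {p : ℝ × ℝ | p.1 ≤ p.2}.indicator fun p => f p.2 := by
        ext p; simp [Set.indicator]
      rw [this]
      exact (hf.comp measurable_snd).indicator (measurableSet_le measurable_fst measurable_snd)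
    rw [lintegral_const_mul _ hm.lintegral_prod_right', lintegral_lintegral_swap hm.aemeasurable,
      ← lintegral_const_mul _ hm.lintegral_prod_left']
    refine lintegral_congr fun w => ?_
    have : ∀ s, (Set.Ici s).indicator f w = (Set.Iic w).indicator (fun _ => f w) s := by
      intro s; simp [Set.indicator]
    simp_rw [this]
    rw [lintegral_indicator measurableSet_Iic, setLIntegral_const, mul_assoc]
  rw [h1, lintegral_expMeasure _ hf, ← lintegral_add_left (f := fun w => exponentialPDF r w * f w)
    ((measurable_exponentialPDF r).mul hf), tailMean_eq_indicator, ← lintegral_const_mul _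
    (hf.indicator measurableSet_Ici)]
  refine lintegral_congr fun w => ?_
  rw [exponentialPDF_eq, expMeasure_Iic hr]
  by_cases hw : 0 ≤ w
  · rw [if_pos hw, if_pos hw, Set.indicator_of_mem (by exact hw)]
    have hle : Real.exp (-(r * w)) ≤ 1 := Real.exp_le_one_iff.mpr (by nlinarith)
    rw [mul_right_comm, ← add_mul, ← ENNReal.ofReal_mul hr.le, ← ENNReal.ofReal_add
      (by positivity) (mul_nonneg hr.le (by linarith))]
    congr 2; ring
  · rw [if_neg hw, if_neg hw, Set.indicator_of_notMem (by exact hw)]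
    simp

/-- The law of an i.i.d. sequence of exponential gaps of rate `r`. -/
noncomputable abbrev gapLaw (r : ℝ) : Measure (ℕ → ℝ) :=
  Measure.infinitePi fun _ : ℕ => expMeasure r

theorem lintegral_arrival_zero (hr : 0 < r) {f : ℝ → ℝ≥0∞} (hf : Measurable f) :
    ∫⁻ a, f (arrival a 0) ∂(gapLaw r) = ∫⁻ s, f s ∂(expMeasure r) := by
  have := isProbabilityMeasure_expMeasure hr
  rw [lintegral_infinitePi_eq_seqCons (Φ := fun a => f (arrival a 0))
    (hf.comp (measurable_arrival 0))]
  simp [arrival_seqCons_zero]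

theorem lintegral_arrival_succ (hr : 0 < r) {f : ℝ → ℝ≥0∞} (hf : Measurable f) (n : ℕ) :
    ∫⁻ a, f (arrival a (n + 1)) ∂(gapLaw r) =
      ∫⁻ s, ∫⁻ a, f (s + arrival a n) ∂(gapLaw r) ∂(expMeasure r) := by
  have := isProbabilityMeasure_expMeasure hr
  rw [lintegral_infinitePi_eq_seqCons (Φ := fun a => f (arrival a (n + 1)))
    (hf.comp (measurable_arrival _))]
  simp_rw [arrival_seqCons_succ]

/-- The renewal equation iterated. -/
theorem sum_lintegral_arrival_add (hr : 0 < r) {f : ℝ → ℝ≥0∞} (hf : Measurable f) (n : ℕ) :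
    ∑ j ∈ Finset.range (n + 1), ∫⁻ a, f (arrival a j) ∂(gapLaw r) +
      ∫⁻ a, tailMean r f (arrival a n) ∂(gapLaw r) = tailMean r f 0 := by
  have := isProbabilityMeasure_expMeasure hr
  induction n generalizing f with
  | zero =>
    rw [Finset.sum_range_one, lintegral_arrival_zero hr hf,
      lintegral_arrival_zero hr (measurable_tailMean r hf),
      lintegral_expMeasure_add_tailMean hr hf]
  | succ n ih =>
    have hadd : ∀ j {g : ℝ → ℝ≥0∞}, Measurable g →
        Measurable fun s => ∫⁻ a, g (s + arrival a j) ∂(gapLaw r) := by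
      intro j g hg
      refine Measurable.lintegral_prod_right'
        (f := fun p : ℝ × (ℕ → ℝ) => g (p.1 + arrival p.2 j)) ?_
      exact hg.comp (measurable_fst.add ((measurable_arrival j).comp measurable_snd))
    rw [Finset.sum_range_succ', lintegral_arrival_zero hr hf,
      lintegral_arrival_succ hr (measurable_tailMean r hf)]
    simp_rw [lintegral_arrival_succ hr hf]
    rw [← lintegral_finsetSum _ (fun j _ => hadd j hf), add_right_comm,
      ← lintegral_add_right _ (hadd n (measurable_tailMean r hf))]
    have h1 : ∀ s, ∑ j ∈ Finset.range (n + 1), ∫⁻ a, f (s + arrival a j) ∂(gapLaw r) +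
        ∫⁻ a, tailMean r f (s + arrival a n) ∂(gapLaw r) = tailMean r f s := by
      intro s
      have := ih (f := fun w => f (s + w)) (by fun_prop)
      simp_rw [tailMean_comp_add, add_zero] at this
      exact this
    simp_rw [h1]
    rw [add_comm, lintegral_expMeasure_add_tailMean hr hf]

/-- One half of Campbell's formula, which needs no assumption on `f`. -/
theorem tsum_lintegral_arrival_le (hr : 0 < r) {f : ℝ → ℝ≥0∞} (hf : Measurable f) :
    ∑' j, ∫⁻ a, f (arrival a j) ∂(gapLaw r) ≤ tailMean r f 0 :=
  ENNReal.tsum_le_of_sum_range_le fun n => by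
    rw [← sum_lintegral_arrival_add hr hf n]
    exact (Finset.sum_le_sum_of_subset (Finset.range_mono (Nat.le_succ n))).trans le_self_add

/-- Only finitely many points are expected up to time `t`, so that the `n`-th point is unlikely to
be among them. -/
theorem tendsto_measure_arrival_le (hr : 0 < r) (t : ℝ) :
    Tendsto (fun n => gapLaw r {a | arrival a n ≤ t}) atTop (𝓝 0) := by
  have hm : Measurable ((Set.Iic t).indicator fun _ => (1 : ℝ≥0∞)) :=
    measurable_const.indicator measurableSet_Iic
  have h1 : ∀ n, gapLaw r {a | arrival a n ≤ t} =
      ∫⁻ a, (Set.Iic t).indicator (fun _ => 1) (arrival a n) ∂(gapLaw r) := by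
    intro n
    have hs : MeasurableSet {a : ℕ → ℝ | arrival a n ≤ t} :=
      measurableSet_le (measurable_arrival n) measurable_const
    rw [← lintegral_indicator_one hs]
    rfl
  simp_rw [h1]
  refine ENNReal.tendsto_atTop_zero_of_tsum_ne_top
    (ne_top_of_le_ne_top ?_ (tsum_lintegral_arrival_le hr hm))
  rw [tailMean, lintegral_indicator measurableSet_Iic, Measure.restrict_restrict measurableSet_Iic]
  refine ENNReal.mul_ne_top ENNReal.ofReal_ne_top ?_
  simp [Set.inter_comm (Set.Iic t), Set.Ici_inter_Iic]

/-- Campbell's formula for the points of a Poisson process, for functions supported on a half-line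
`(-∞, t]`. -/
theorem tsum_lintegral_arrival (hr : 0 < r) {f : ℝ → ℝ≥0∞} (hf : Measurable f) {t : ℝ}
    (hft : ∀ s, t < s → f s = 0) (hfin : ∫⁻ s, f s ≠ ∞) :
    ∑' j, ∫⁻ a, f (arrival a j) ∂(gapLaw r) = tailMean r f 0 := by
  set c : ℝ≥0∞ := ENNReal.ofReal r * ∫⁻ s, f s with hc
  have hcfin : c ≠ ∞ := ENNReal.mul_ne_top ENNReal.ofReal_ne_top hfin
  have hrem : ∀ n, ∫⁻ a, tailMean r f (arrival a n) ∂(gapLaw r) ≤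
      c * gapLaw r {a | arrival a n ≤ t} := by
    intro n
    have hs : MeasurableSet {a : ℕ → ℝ | arrival a n ≤ t} :=
      measurableSet_le (measurable_arrival n) measurable_const
    rw [← setLIntegral_const, ← lintegral_indicator hs]
    refine lintegral_mono fun a => ?_
    by_cases ha : arrival a n ≤ t
    · rw [Set.indicator_of_mem (by exact ha)]
      exact mul_le_mul_right (setLIntegral_le_lintegral _ _) _
    · rw [tailMean, setLIntegral_congr_fun (g := fun _ => 0) measurableSet_Ici
        (fun s hs => hft s ((not_le.mp ha).trans_le hs))]
      simp
  have hlim : Tendsto (fun n => ∑ j ∈ Finset.range (n + 1), ∫⁻ a, f (arrival a j) ∂(gapLaw r) +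
      ∫⁻ a, tailMean r f (arrival a n) ∂(gapLaw r)) atTop
      (𝓝 (∑' j, ∫⁻ a, f (arrival a j) ∂(gapLaw r) + 0)) := by
    refine Tendsto.add ((ENNReal.tendsto_nat_tsum _).comp (tendsto_add_atTop_nat 1)) ?_
    refine tendsto_of_tendsto_of_tendsto_of_le_of_le tendsto_const_nhds ?_
      (fun _ => zero_le) hrem
    simpa using ENNReal.Tendsto.const_mul (tendsto_measure_arrival_le hr t) (Or.inr hcfin)
  simp_rw [sum_lintegral_arrival_add hr hf] at hlim
  rw [add_zero] at hlim
  exact tendsto_nhds_unique hlim tendsto_const_nhds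

/-- The second-order Campbell formula, as an upper bound: given a point at `s`, the points after `s`
form again a Poisson process. -/
theorem tsum_tsum_lintegral_arrival_le (hr : 0 < r) {f : ℝ → ℝ≥0∞} (hf : Measurable f) :
    ∑' i, ∑' d, ∫⁻ a, f (arrival a i) * f (arrival a (i + 1 + d)) ∂(gapLaw r) ≤
      tailMean r (fun s => f s * tailMean r f s) 0 := by
  have := isProbabilityMeasure_expMeasure hr
  have hpair : ∀ i {f : ℝ → ℝ≥0∞}, Measurable f →
      ∑' d, ∫⁻ a, f (arrival a i) * f (arrival a (i + 1 + d)) ∂(gapLaw r) ≤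
        ∫⁻ a, f (arrival a i) * tailMean r f (arrival a i) ∂(gapLaw r) := by
    intro i
    induction i with
    | zero =>
      intro f hf
      have hterm : ∀ d, ∫⁻ a, f (arrival a 0) * f (arrival a (0 + 1 + d)) ∂(gapLaw r) =
          ∫⁻ s, f s * ∫⁻ a, f (s + arrival a d) ∂(gapLaw r) ∂(expMeasure r) := by
        intro d
        rw [lintegral_infinitePi_eq_seqCons
          (Φ := fun a => f (arrival a 0) * f (arrival a (0 + 1 + d)))
          ((hf.comp (measurable_arrival _)).mul (hf.comp (measurable_arrival _)))]
        refine lintegral_congr fun s => ?_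
        rw [show 0 + 1 + d = d + 1 by ring]
        simp_rw [arrival_seqCons_succ, arrival_seqCons_zero]
        exact lintegral_const_mul _ (hf.comp (measurable_const.add (measurable_arrival d)))
      have hm : ∀ d, Measurable fun s => f s * ∫⁻ a, f (s + arrival a d) ∂(gapLaw r) := by
        intro d
        refine hf.mul (Measurable.lintegral_prod_right'
          (f := fun p : ℝ × (ℕ → ℝ) => f (p.1 + arrival p.2 d)) ?_)
        exact hf.comp (measurable_fst.add ((measurable_arrival d).comp measurable_snd))
      simp_rw [hterm]
      rw [← lintegral_tsum fun d => (hm d).aemeasurable,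
        lintegral_arrival_zero hr (f := fun s => f s * tailMean r f s)
          (hf.mul (measurable_tailMean r hf))]
      refine lintegral_mono fun s => ?_
      rw [ENNReal.tsum_mul_left]
      gcongr
      have := tsum_lintegral_arrival_le hr (f := fun w => f (s + w)) (by fun_prop)
      rwa [tailMean_comp_add, add_zero] at this
    | succ i ih =>
      intro f hf
      have hterm : ∀ d, ∫⁻ a, f (arrival a (i + 1)) * f (arrival a (i + 1 + 1 + d)) ∂(gapLaw r) =
          ∫⁻ s, ∫⁻ a, f (s + arrival a i) * f (s + arrival a (i + 1 + d)) ∂(gapLaw r)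
            ∂(expMeasure r) := by
        intro d
        rw [lintegral_infinitePi_eq_seqCons
          (Φ := fun a => f (arrival a (i + 1)) * f (arrival a (i + 1 + 1 + d)))
          ((hf.comp (measurable_arrival _)).mul (hf.comp (measurable_arrival _)))]
        rw [show i + 1 + 1 + d = (i + 1 + d) + 1 by ring]
        simp_rw [arrival_seqCons_succ]
      have hm : ∀ d, Measurable fun s => ∫⁻ a, f (s + arrival a i) * f (s + arrival a (i + 1 + d))
          ∂(gapLaw r) := by
        intro d
        refine Measurable.lintegral_prod_right'
          (f := fun p : ℝ × (ℕ → ℝ) =>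
            f (p.1 + arrival p.2 i) * f (p.1 + arrival p.2 (i + 1 + d))) ?_
        exact (hf.comp (measurable_fst.add ((measurable_arrival _).comp measurable_snd))).mul
          (hf.comp (measurable_fst.add ((measurable_arrival _).comp measurable_snd)))
      simp_rw [hterm]
      rw [← lintegral_tsum fun d => (hm d).aemeasurable,
        lintegral_arrival_succ hr (f := fun s => f s * tailMean r f s)
          (hf.mul (measurable_tailMean r hf))]
      refine lintegral_mono fun s => ?_
      have := ih (f := fun w => f (s + w)) (by fun_prop)
      simp_rw [tailMean_comp_add] at this
      exact this
  exact (ENNReal.tsum_le_tsum fun i => hpair i hf).trans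
    (tsum_lintegral_arrival_le hr (hf.mul (measurable_tailMean r hf)))

/-- The integral over `s ≤ w` of the symmetric function `f s * f w` is half of the one over the
plane; `tailMean` takes only the part with `0 ≤ s`. -/
theorem two_mul_tailMean_mul_tailMean_le {f : ℝ → ℝ≥0∞} (hf : Measurable f) :
    2 * tailMean r (fun s => f s * tailMean r f s) 0 ≤ (ENNReal.ofReal r * ∫⁻ s, f s) ^ 2 := by
  set F : ℝ × ℝ → ℝ≥0∞ := {p : ℝ × ℝ | p.1 ≤ p.2}.indicator fun p => f p.1 * f p.2 with hF
  have hFm : Measurable F := (by fun_prop : Measurable fun p : ℝ × ℝ => f p.1 * f p.2).indicator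
    (measurableSet_le measurable_fst measurable_snd)
  have h1 : tailMean r (fun s => f s * tailMean r f s) 0 ≤
      ENNReal.ofReal r ^ 2 * ∫⁻ s, ∫⁻ w, F (s, w) := by
    rw [tailMean]
    calc ENNReal.ofReal r * ∫⁻ s in Set.Ici 0, f s * tailMean r f s
        ≤ ENNReal.ofReal r * ∫⁻ s, f s * tailMean r f s := by
          exact mul_le_mul_right (setLIntegral_le_lintegral _ _) _
      _ = ENNReal.ofReal r * ∫⁻ s, ENNReal.ofReal r * ∫⁻ w, F (s, w) := by
          congr 1
          refine lintegral_congr fun s => ?_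
          rw [tailMean_eq_indicator, mul_left_comm, ← lintegral_const_mul _
            (hf.indicator measurableSet_Ici)]
          congr 1
          refine lintegral_congr fun w => ?_
          by_cases h : s ≤ w <;> simp [hF, Set.indicator, h]
      _ = _ := by rw [lintegral_const_mul _ hFm.lintegral_prod_right', ← mul_assoc, sq]
  have h2 : (∫⁻ s, ∫⁻ w, F (s, w)) + (∫⁻ s, ∫⁻ w, F (w, s)) = (∫⁻ s, f s) ^ 2 := by
    rw [← lintegral_add_left hFm.lintegral_prod_right', sq, ← lintegral_mul_const _ hf]
    refine lintegral_congr fun s => ?_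
    rw [← lintegral_add_left (f := fun w => F (s, w)) (hFm.comp measurable_prodMk_left),
      ← lintegral_const_mul _ hf]
    refine lintegral_congr_ae ?_
    have : ∀ᵐ w : ℝ, w ≠ s := by simp [ae_iff]
    filter_upwards [this] with w hw
    rcases lt_or_gt_of_ne hw with h | h
    · simp [hF, h.le, not_le.mpr h, mul_comm]
    · simp [hF, h.le, not_le.mpr h]
  have h3 : ∫⁻ s, ∫⁻ w, F (w, s) = ∫⁻ s, ∫⁻ w, F (s, w) :=
    lintegral_lintegral_swap (f := fun s w => F (w, s)) (hFm.comp measurable_swap).aemeasurable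
  rw [h3, ← two_mul] at h2
  rw [mul_pow, ← h2, mul_left_comm]
  gcongr

end PoissonProcess

/-! ### Counting -/

section Counting

/-- Only an inequality, as the cardinality `Set.ncard` of an infinite set is `0`. -/
theorem natCast_ncard_le_tsum (s : Set ℕ) :
    (s.ncard : ℝ≥0∞) ≤ ∑' j, s.indicator (fun _ => (1 : ℝ≥0∞)) j := by
  rw [← tsum_subtype, ENNReal.tsum_set_one]
  rcases s.finite_or_infinite with h | h
  · rw [← h.cast_ncard_eq]; simp
  · rw [h.ncard]; simp

theorem natCast_ncard_eq_tsum {s : Set ℕ} (hs : ∑' j, s.indicator (fun _ => (1 : ℝ≥0∞)) j ≠ ∞) :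
    (s.ncard : ℝ≥0∞) = ∑' j, s.indicator (fun _ => (1 : ℝ≥0∞)) j := by
  rw [← tsum_subtype, ENNReal.tsum_set_one] at hs ⊢
  rcases s.finite_or_infinite with h | h
  · rw [← h.cast_ncard_eq]; simp
  · rw [h.encard_eq] at hs; simp at hs

theorem measurable_ncard_setOf {Ω : Type*} [MeasurableSpace Ω] {s : Ω → Set ℕ}
    (hs : ∀ j, MeasurableSet {ω | j ∈ s ω}) : Measurable fun ω => (s ω).ncard :=
  measurable_ncard.comp (measurable_set_iff.mpr fun j => measurableSet_setOfPred.mp (hs j))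

theorem tsum_lt_eq_tsum_add (F : ℕ → ℕ → ℝ≥0∞) :
    ∑' j, ∑ i ∈ Finset.range j, F i j = ∑' i, ∑' d, F i (i + 1 + d) := by
  have h1 : ∀ j, ∑ i ∈ Finset.range j, F i j = ∑' i, if i < j then F i j else 0 := by
    intro j
    rw [tsum_eq_sum (s := Finset.range j) (fun i hi => if_neg (by simpa using hi))]
    exact Finset.sum_congr rfl fun i hi => (if_pos (Finset.mem_range.mp hi)).symm
  simp_rw [h1]
  rw [ENNReal.tsum_comm]
  refine tsum_congr fun i => ?_
  have hinj : Function.Injective fun d : ℕ => i + 1 + d := add_right_injective (i + 1)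
  rw [← hinj.tsum_eq]
  · exact tsum_congr fun d => if_pos (by omega)
  · intro j hj
    have : i < j := by
      by_contra hij
      simp [hij] at hj
    exact ⟨j - (i + 1), by simp only; omega⟩

/-- The square of a number of points in terms of the number of ordered pairs of distinct points. -/
theorem sq_tsum_le {x : ℕ → ℝ≥0∞} (hx : ∀ j, x j ^ 2 ≤ x j) :
    (∑' j, x j) ^ 2 ≤ ∑' j, x j + 2 * ∑' i, ∑' d, x i * x (i + 1 + d) := by
  have hfin : ∀ n, (∑ j ∈ Finset.range n, x j) ^ 2 ≤ ∑ j ∈ Finset.range n, x j +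
      2 * ∑ j ∈ Finset.range n, ∑ i ∈ Finset.range j, x i * x j := by
    intro n
    induction n with
    | zero => simp
    | succ n ih =>
      rw [Finset.sum_range_succ, Finset.sum_range_succ (fun j => ∑ i ∈ Finset.range j, x i * x j),
        ← Finset.sum_mul]
      calc (∑ j ∈ Finset.range n, x j + x n) ^ 2
          = (∑ j ∈ Finset.range n, x j) ^ 2 + x n ^ 2 +
              2 * ((∑ j ∈ Finset.range n, x j) * x n) := by
            ring
        _ ≤ (∑ j ∈ Finset.range n, x j +
              2 * ∑ j ∈ Finset.range n, ∑ i ∈ Finset.range j, x i * x j) + x n +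
              2 * ((∑ j ∈ Finset.range n, x j) * x n) := by
            gcongr
            exact hx n
        _ = _ := by ring
  rw [← tsum_lt_eq_tsum_add fun i j => x i * x j]
  have hlim : Tendsto (fun n => (∑ j ∈ Finset.range n, x j) ^ 2) atTop (𝓝 ((∑' j, x j) ^ 2)) :=
    ENNReal.Tendsto.pow (ENNReal.tendsto_nat_tsum x)
  refine le_of_tendsto hlim (Eventually.of_forall fun n => (hfin n).trans ?_)
  gcongr
  · exact ENNReal.sum_le_tsum _
  · exact ENNReal.sum_le_tsum _

end Counting

/-! ### Departures: the infinite-server queue -/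

namespace PoissonProcess

/-- The points `j` that have occurred by time `t` and whose lifespan has not yet ended. -/
def aliveSet (a l : ℕ → ℝ) (t : ℝ) : Set ℕ := {j | arrival a j ≤ t ∧ t < arrival a j + l j}

/-- The indicator of a point at `s` with lifespan `x` being alive at time `t`. -/
noncomputable def aliveAt (t s x : ℝ) : ℝ≥0∞ :=
  {p : ℝ × ℝ | p.1 ≤ t ∧ t < p.1 + p.2}.indicator 1 (s, x)

/-- The probability that a point at `s` with an exponential lifespan of rate `μ` is alive at time
`t`. -/
noncomputable def survival (μ t s : ℝ) : ℝ≥0∞ := (ENNReal.ofReal μ)⁻¹ * exponentialPDF μ (t - s)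

theorem measurable_survival (μ t : ℝ) : Measurable (survival μ t) :=
  ((measurable_exponentialPDF μ).comp (measurable_const.sub measurable_id)).const_mul _

theorem measurable_aliveAt (t : ℝ) : Measurable fun p : ℝ × ℝ => aliveAt t p.1 p.2 :=
  measurable_const.indicator ((measurableSet_le measurable_fst measurable_const).inter
    (measurableSet_lt measurable_const (measurable_fst.add measurable_snd)))

theorem aliveSet_indicator (a l : ℕ → ℝ) (t : ℝ) (j : ℕ) :
    (aliveSet a l t).indicator (fun _ => (1 : ℝ≥0∞)) j = aliveAt t (arrival a j) (l j) := rfl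

variable {r μ : ℝ}

theorem lintegral_aliveAt (hμ : 0 < μ) (t s : ℝ) :
    ∫⁻ x, aliveAt t s x ∂(expMeasure μ) = survival μ t s := by
  by_cases hs : s ≤ t
  · have : ∀ x, aliveAt t s x = (Set.Ioi (t - s)).indicator 1 x := by
      intro x
      simp [aliveAt, Set.indicator, hs, sub_lt_iff_lt_add']
    simp_rw [this]
    rw [lintegral_indicator_one measurableSet_Ioi, survival, expMeasure_Ioi_eq_pdf hμ (by linarith)]
  · have : ∀ x, aliveAt t s x = 0 := fun x => by simp [aliveAt, hs]
    simp_rw [this]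
    rw [lintegral_zero, survival, exponentialPDF_of_neg (by linarith), mul_zero]

theorem survival_of_lt {t s : ℝ} (h : t < s) : survival μ t s = 0 := by
  rw [survival, exponentialPDF_of_neg (by linarith), mul_zero]

theorem lintegral_survival (hμ : 0 < μ) (t : ℝ) :
    ∫⁻ s, survival μ t s = (ENNReal.ofReal μ)⁻¹ := by
  unfold survival
  rw [lintegral_const_mul _ (f := fun s => exponentialPDF μ (t - s))
    ((measurable_exponentialPDF μ).comp (measurable_const.sub measurable_id)),
    lintegral_sub_left_eq_self (exponentialPDF μ) t,
    lintegral_exponentialPDF_eq_one hμ, mul_one]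

theorem tailMean_survival (t : ℝ) :
    tailMean r (survival μ t) 0 =
      ENNReal.ofReal r * ((ENNReal.ofReal μ)⁻¹ * expMeasure μ (Set.Iic t)) := by
  rw [tailMean_eq_indicator, expMeasure_eq_withDensity, withDensity_apply _ measurableSet_Iic,
    ← lintegral_indicator measurableSet_Iic,
    ← lintegral_sub_left_eq_self ((Set.Iic t).indicator (exponentialPDF μ)) t,
    ← lintegral_const_mul _ (f := fun s => (Set.Iic t).indicator (exponentialPDF μ) (t - s))]
  · congr 1
    refine lintegral_congr fun s => ?_
    by_cases h : 0 ≤ s <;> simp [Set.indicator, survival, h]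
  · exact ((measurable_exponentialPDF μ).indicator measurableSet_Iic).comp
      (measurable_const.sub measurable_id)

theorem measurable_aliveAt_arrival (t : ℝ) (j : ℕ) :
    Measurable fun p : (ℕ → ℝ) × (ℕ → ℝ) => aliveAt t (arrival p.1 j) (p.2 j) :=
  (measurable_aliveAt t).comp (((measurable_arrival j).comp measurable_fst).prodMk
    ((measurable_pi_apply j).comp measurable_snd))

theorem lintegral_aliveAt_arrival (hr : 0 < r) (hμ : 0 < μ) (t : ℝ) (j : ℕ) :
    ∫⁻ p, aliveAt t (arrival p.1 j) (p.2 j) ∂((gapLaw r).prod (gapLaw μ)) =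
      ∫⁻ a, survival μ t (arrival a j) ∂(gapLaw r) := by
  have := isProbabilityMeasure_expMeasure hr
  have := isProbabilityMeasure_expMeasure hμ
  rw [lintegral_prod _ (measurable_aliveAt_arrival t j).aemeasurable]
  refine lintegral_congr fun a => ?_
  rw [← lintegral_aliveAt hμ, ← Measure.infinitePi_map_eval (fun _ : ℕ => expMeasure μ) j,
    lintegral_map (f := aliveAt t (arrival a j))
      ((measurable_aliveAt t).comp measurable_prodMk_left) (measurable_pi_apply j)]

theorem lintegral_aliveAt_mul_aliveAt (hr : 0 < r) (hμ : 0 < μ) (t : ℝ) {i j : ℕ} (hij : i ≠ j) :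
    ∫⁻ p, aliveAt t (arrival p.1 i) (p.2 i) * aliveAt t (arrival p.1 j) (p.2 j)
        ∂((gapLaw r).prod (gapLaw μ)) =
      ∫⁻ a, survival μ t (arrival a i) * survival μ t (arrival a j) ∂(gapLaw r) := by
  have := isProbabilityMeasure_expMeasure hr
  have := isProbabilityMeasure_expMeasure hμ
  rw [lintegral_prod (fun p : (ℕ → ℝ) × (ℕ → ℝ) => _ * _) ((measurable_aliveAt_arrival t i).mul
    (measurable_aliveAt_arrival t j)).aemeasurable]
  refine lintegral_congr fun a => ?_
  have h1 : ∀ k, Measurable (aliveAt t (arrival a k)) := fun k =>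
    (measurable_aliveAt t).comp measurable_prodMk_left
  rw [← lintegral_aliveAt hμ, ← lintegral_aliveAt hμ,
    ← lintegral_prod_mul (h1 i).aemeasurable (h1 j).aemeasurable,
    ← Measure.infinitePi_map_eval_prod (P := fun _ : ℕ => expMeasure μ) hij,
    lintegral_map (f := fun z : ℝ × ℝ => aliveAt t (arrival a i) z.1 * aliveAt t (arrival a j) z.2)
      (((h1 i).comp measurable_fst).mul ((h1 j).comp measurable_snd))
      ((measurable_pi_apply i).prodMk (measurable_pi_apply j))]

/-- The mean number of points alive at time `t`. -/
theorem lintegral_tsum_aliveSet (hr : 0 < r) (hμ : 0 < μ) (t : ℝ) :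
    ∫⁻ p, ∑' j, (aliveSet p.1 p.2 t).indicator (fun _ => (1 : ℝ≥0∞)) j
        ∂((gapLaw r).prod (gapLaw μ)) =
      ENNReal.ofReal r * ((ENNReal.ofReal μ)⁻¹ * expMeasure μ (Set.Iic t)) := by
  simp_rw [aliveSet_indicator]
  rw [lintegral_tsum fun j => (measurable_aliveAt_arrival t j).aemeasurable]
  simp_rw [lintegral_aliveAt_arrival hr hμ]
  rw [tsum_lintegral_arrival hr (measurable_survival μ t) (t := t) (fun s hs => survival_of_lt hs),
    tailMean_survival]
  rw [lintegral_survival hμ]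
  simpa using hμ

/-- The second factorial moment of the number of points alive at time `t` is at most
`(r / μ) ^ 2`, and its mean at most `r / μ`. -/
theorem lintegral_tsum_aliveSet_sq_le (hr : 0 < r) (hμ : 0 < μ) (t : ℝ) :
    ∫⁻ p, (∑' j, (aliveSet p.1 p.2 t).indicator (fun _ => (1 : ℝ≥0∞)) j) ^ 2
        ∂((gapLaw r).prod (gapLaw μ)) ≤
      ENNReal.ofReal r * (ENNReal.ofReal μ)⁻¹ + (ENNReal.ofReal r * (ENNReal.ofReal μ)⁻¹) ^ 2 := by
  have := isProbabilityMeasure_expMeasure hr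
  have := isProbabilityMeasure_expMeasure hμ
  have hm := measurable_aliveAt_arrival t
  calc ∫⁻ p, (∑' j, (aliveSet p.1 p.2 t).indicator (fun _ => (1 : ℝ≥0∞)) j) ^ 2
        ∂((gapLaw r).prod (gapLaw μ))
      ≤ ∫⁻ p, (∑' j, (aliveSet p.1 p.2 t).indicator (fun _ => (1 : ℝ≥0∞)) j +
          2 * ∑' i, ∑' d, aliveAt t (arrival p.1 i) (p.2 i) *
            aliveAt t (arrival p.1 (i + 1 + d)) (p.2 (i + 1 + d)))
        ∂((gapLaw r).prod (gapLaw μ)) := by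
        refine lintegral_mono fun p => sq_tsum_le fun j => ?_
        by_cases h : j ∈ aliveSet p.1 p.2 t <;> simp [h]
    _ = ENNReal.ofReal r * ((ENNReal.ofReal μ)⁻¹ * expMeasure μ (Set.Iic t)) +
        2 * ∑' i, ∑' d, ∫⁻ a, survival μ t (arrival a i) * survival μ t (arrival a (i + 1 + d))
          ∂(gapLaw r) := by
        have hm2 : ∀ i d, Measurable fun p : (ℕ → ℝ) × (ℕ → ℝ) =>
            aliveAt t (arrival p.1 i) (p.2 i) *
              aliveAt t (arrival p.1 (i + 1 + d)) (p.2 (i + 1 + d)) :=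
          fun i d => (hm i).mul (hm (i + 1 + d))
        rw [lintegral_add_left (f := fun p : (ℕ → ℝ) × (ℕ → ℝ) =>
            ∑' j, (aliveSet p.1 p.2 t).indicator (fun _ => (1 : ℝ≥0∞)) j)
            (Measurable.tsum fun j => hm j),
          lintegral_tsum_aliveSet hr hμ, lintegral_const_mul _
            (Measurable.tsum fun i => Measurable.tsum fun d => hm2 i d),
          lintegral_tsum fun i => (Measurable.tsum fun d => hm2 i d).aemeasurable]
        congr 2
        refine tsum_congr fun i => ?_
        rw [lintegral_tsum fun d => (hm2 i d).aemeasurable]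
        exact tsum_congr fun d => lintegral_aliveAt_mul_aliveAt hr hμ t (by omega)
    _ ≤ _ := by
        gcongr
        · exact mul_le_of_le_one_right' prob_le_one
        · refine le_trans ?_ ((two_mul_tailMean_mul_tailMean_le (r := r)
            (measurable_survival μ t)).trans_eq (by rw [lintegral_survival hμ]))
          gcongr
          exact tsum_tsum_lintegral_arrival_le hr (measurable_survival μ t)

end PoissonProcess

/-! ### One step of the embedded chain -/

namespace RewardModel

open PoissonProcess

variable {K : ℕ}

/-- The number of the `q k` initial rewards of action `k` that outlive the first update period. -/
noncomputable def survivors (q : Fin K → ℕ) (ω : Driving K) (k : Fin K) : ℕ :=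
  {j : ℕ | j < q k ∧ ω.updateGap 0 < ω.initialLifespan k j}.ncard

/-- The number of rewards of action `k` that occur in the first update period and are still present
at its end. -/
noncomputable def accrued (ω : Driving K) (k : Fin K) : ℕ :=
  (aliveSet (ω.arrivalGap k) (ω.lifespan k) (ω.updateGap 0)).ncard

/-- The rewards at the first update point, from the state `x`. -/
noncomputable def nextRewards (x : RewardState K) (ω : Driving K) (k : Fin K) : ℕ :=
  survivors x.1 ω k + if x.2 = k then accrued ω k else 0

/-- The state at the first update point, from the state `x`. -/
noncomputable def step [NeZero K] (M : RewardModel K) (x : RewardState K) (ω : Driving K) :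
    RewardState K :=
  (nextRewards x ω, M.newChoice (nextRewards x ω) (ω.unif 0))

/-- Arrivals up to the first update point belong to the period of the initial choice, as the arrival
times are positive and the update points increase. -/
theorem rewardsUnder_updateTime_one {ω : Driving K} (hτ : ∀ n, 0 < ω.updateGap n)
    (ha : ∀ k j, 0 < ω.arrivalGap k j) (x : RewardState K) {c : ℕ → Fin K} (hc : c 0 = x.2) :
    rewardsUnder x.1 c ω (ω.updateTime 1) = nextRewards x ω := by
  have h1 : ω.updateTime 1 = ω.updateGap 0 := by simp [Driving.updateTime]
  have hmono : StrictMono ω.updateTime := strictMono_nat_of_lt_succ fun n => by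
    simp only [Driving.updateTime, Finset.sum_range_succ]
    linarith [hτ n]
  funext k
  unfold rewardsUnder nextRewards survivors accrued
  rw [h1]
  congr 1
  have harr : ∀ j, ω.arrivalTime k j = arrival (ω.arrivalGap k) j := fun j => rfl
  have hpos : ∀ j, 0 < ω.arrivalTime k j := fun j =>
    Finset.sum_pos (fun i _ => ha k i) ⟨0, by simp⟩
  split_ifs with hk
  · congr 1
    ext j
    simp only [Set.mem_ofPred_eq, aliveSet, ← harr]
    constructor
    · rintro ⟨h2, h3, -⟩
      exact ⟨h2, h3⟩
    · rintro ⟨h2, h3⟩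
      exact ⟨h2, h3, 0, by simpa [Driving.updateTime] using hpos j, by rwa [zero_add, h1],
        hc.trans hk⟩
  · refine (congrArg Set.ncard (Set.eq_empty_of_forall_notMem ?_)).trans (Set.ncard_empty ℕ)
    rintro j ⟨h2, -, n, h3, -, h5⟩
    have : n < 1 := hmono.lt_iff_lt.mp (h3.trans_le (h2.trans_eq h1.symm))
    obtain rfl : n = 0 := by omega
    exact hk (hc.symm.trans h5)

/-- As the update points are distinct, the last one up to the `n`-th is the `n`-th itself. -/
theorem choiceAt_updateTime [NeZero K] (M : RewardModel K) {ω : Driving K}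
    (hτ : ∀ n, 0 < ω.updateGap n) (x : RewardState K) (n : ℕ) :
    M.choiceAt x ω (ω.updateTime n) = M.choiceMade x ω n := by
  have hmono : StrictMono ω.updateTime := strictMono_nat_of_lt_succ fun n => by
    simp only [Driving.updateTime, Finset.sum_range_succ]
    linarith [hτ n]
  unfold choiceAt
  simp_rw [hmono.le_iff_le]
  congr 1
  exact csSup_Iic

theorem embedded_one_eq_step [NeZero K] (M : RewardModel K) {ω : Driving K}
    (hτ : ∀ n, 0 < ω.updateGap n) (ha : ∀ k j, 0 < ω.arrivalGap k j) (x : RewardState K) :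
    M.embedded x ω 1 = M.step x ω := by
  unfold embedded jointAt step
  rw [choiceAt_updateTime M hτ]
  unfold rewardAt choiceMade
  rw [rewardsUnder_updateTime_one hτ ha x (by rfl)]
  simp only [history]
  rw [if_neg (by norm_num), rewardsUnder_updateTime_one hτ ha x (by rfl)]

theorem embedded_zero_snd [NeZero K] (M : RewardModel K) {ω : Driving K}
    (hτ : ∀ n, 0 < ω.updateGap n) (x : RewardState K) : (M.embedded x ω 0).2 = x.2 :=
  choiceAt_updateTime M hτ x 0

/-! ### Marginals of the driving randomness -/

variable (M : RewardModel K)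

instance isProbabilityMeasure_expMeasure_beta : IsProbabilityMeasure (expMeasure M.beta) :=
  isProbabilityMeasure_expMeasure M.beta_pos

instance isProbabilityMeasure_expMeasure_mu : IsProbabilityMeasure (expMeasure M.mu) :=
  isProbabilityMeasure_expMeasure M.mu_pos

instance isProbabilityMeasure_expMeasure_lam (k : Fin K) :
    IsProbabilityMeasure (expMeasure (M.lam k)) :=
  isProbabilityMeasure_expMeasure (M.lam_pos k)

/-- The law of the arrival gaps, lifespans and initial lifespans. -/
noncomputable def rewardLaw :
    Measure ((Fin K × ℕ → ℝ) × (Fin K × ℕ → ℝ) × (Fin K × ℕ → ℝ)) :=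
  (Measure.infinitePi fun p : Fin K × ℕ => expMeasure (M.lam p.1)).prod <|
    (Measure.infinitePi fun _ : Fin K × ℕ => expMeasure M.mu).prod <|
      (Measure.infinitePi fun _ : Fin K × ℕ => expMeasure M.mu)

instance : IsProbabilityMeasure M.rewardLaw := by unfold rewardLaw; infer_instance

theorem drivingLaw_eq : M.drivingLaw = (Measure.infinitePi fun _ : ℕ => expMeasure M.beta).prod
    ((Measure.infinitePi fun _ : ℕ => (volume : Measure unitInterval)).prod M.rewardLaw) := rfl

instance : IsProbabilityMeasure M.drivingLaw := by rw [drivingLaw_eq]; infer_instance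

theorem measurePreserving_row {P : Fin K → Measure ℝ} [∀ k, IsProbabilityMeasure (P k)]
    (k : Fin K) :
    MeasurePreserving (fun (a : Fin K × ℕ → ℝ) j => a (k, j))
      (Measure.infinitePi fun p : Fin K × ℕ => P p.1) (Measure.infinitePi fun _ : ℕ => P k) where
  measurable := by fun_prop
  map_eq := Measure.map_infinitePi_infinitePi_of_inj (P := fun p : Fin K × ℕ => P p.1)
    (f := fun j : ℕ => (k, j)) (Prod.mk_right_injective k)

/-- The first update period is independent of the arrivals and lifespans of the rewards of action
`k`. -/
theorem measurePreserving_arrivals (k : Fin K) :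
    MeasurePreserving (fun ω : Driving K => (ω.updateGap 0, ω.arrivalGap k, ω.lifespan k))
      M.drivingLaw ((expMeasure M.beta).prod ((gapLaw (M.lam k)).prod (gapLaw M.mu))) := by
  have h : MeasurePreserving (fun q : (ℕ → unitInterval) × (Fin K × ℕ → ℝ) × (Fin K × ℕ → ℝ) ×
      (Fin K × ℕ → ℝ) => ((fun j => q.2.1 (k, j)), (fun j => q.2.2.1 (k, j))))
      ((Measure.infinitePi fun _ : ℕ => (volume : Measure unitInterval)).prod M.rewardLaw)
      ((gapLaw (M.lam k)).prod (gapLaw M.mu)) :=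
    ((measurePreserving_row (P := fun k => expMeasure (M.lam k)) k).prod
      ((measurePreserving_row (P := fun _ => expMeasure M.mu) k).comp measurePreserving_fst)).comp
        measurePreserving_snd
  exact (measurePreserving_eval_infinitePi (fun _ : ℕ => expMeasure M.beta) 0).prod h

theorem measurePreserving_initialLifespan (k : Fin K) (j : ℕ) :
    MeasurePreserving (fun ω : Driving K => (ω.updateGap 0, ω.initialLifespan k j))
      M.drivingLaw ((expMeasure M.beta).prod (expMeasure M.mu)) := by
  have h : MeasurePreserving (fun q : (ℕ → unitInterval) × (Fin K × ℕ → ℝ) × (Fin K × ℕ → ℝ) ×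
      (Fin K × ℕ → ℝ) => q.2.2.2 (k, j))
      ((Measure.infinitePi fun _ : ℕ => (volume : Measure unitInterval)).prod M.rewardLaw)
      (expMeasure M.mu) :=
    (measurePreserving_eval_infinitePi (fun _ : Fin K × ℕ => expMeasure M.mu) (k, j)).comp
      (measurePreserving_snd.comp (measurePreserving_snd.comp measurePreserving_snd))
  exact (measurePreserving_eval_infinitePi (fun _ : ℕ => expMeasure M.beta) 0).prod h

theorem ae_updateGap_pos : ∀ᵐ ω ∂M.drivingLaw, ∀ n, 0 < ω.updateGap n := by
  rw [ae_all_iff]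
  intro n
  have h : MeasurePreserving (fun ω : Driving K => ω.updateGap n) M.drivingLaw
      (expMeasure M.beta) := by
    rw [drivingLaw_eq]
    exact (measurePreserving_eval_infinitePi (fun _ : ℕ => expMeasure M.beta) n).comp
      measurePreserving_fst
  exact h.quasiMeasurePreserving.ae (ae_pos_expMeasure M.beta_pos)

theorem ae_arrivalGap_pos : ∀ᵐ ω ∂M.drivingLaw, ∀ k j, 0 < ω.arrivalGap k j := by
  rw [ae_all_iff]
  intro k
  rw [ae_all_iff]
  intro n
  have h : MeasurePreserving (fun ω : Driving K => ω.arrivalGap k n) M.drivingLaw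
      (expMeasure (M.lam k)) :=
    (measurePreserving_eval_infinitePi (fun _ : ℕ => expMeasure (M.lam k)) n).comp
      ((measurePreserving_fst.comp measurePreserving_snd).comp (M.measurePreserving_arrivals k))
  exact h.quasiMeasurePreserving.ae (ae_pos_expMeasure (M.lam_pos k))

/-! ### Means of the numbers of surviving and of accrued rewards -/

/-- The probability that a reward outlives an update period. -/
noncomputable def survivalProb : ℝ := M.beta / (M.beta + M.mu)

theorem survivalProb_pos : 0 < M.survivalProb :=
  div_pos M.beta_pos (add_pos M.beta_pos M.mu_pos)

theorem survivalProb_lt_one : M.survivalProb < 1 := by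
  rw [survivalProb, div_lt_one (add_pos M.beta_pos M.mu_pos)]
  linarith [M.mu_pos]

theorem measurable_survivors (q : Fin K → ℕ) (k : Fin K) :
    Measurable fun ω : Driving K => survivors q ω k := by
  refine measurable_ncard_setOf fun j => ?_
  have : {ω : Driving K | j ∈ {j : ℕ | j < q k ∧ ω.updateGap 0 < ω.initialLifespan k j}} =
      {ω | j < q k} ∩ {ω : Driving K | ω.updateGap 0 < ω.initialLifespan k j} := rfl
  rw [this]
  refine (MeasurableSet.const _).inter (measurableSet_lt ?_ ?_)
  · unfold Driving.updateGap; fun_prop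
  · unfold Driving.initialLifespan; fun_prop

theorem measurable_ncard_aliveSet :
    Measurable fun p : ℝ × (ℕ → ℝ) × (ℕ → ℝ) => (aliveSet p.2.1 p.2.2 p.1).ncard := by
  refine measurable_ncard_setOf fun j => ?_
  have h1 : Measurable fun p : ℝ × (ℕ → ℝ) × (ℕ → ℝ) => arrival p.2.1 j :=
    (measurable_arrival j).comp (measurable_fst.comp measurable_snd)
  exact (measurableSet_le h1 measurable_fst).inter
    (measurableSet_lt measurable_fst (h1.add (by fun_prop)))

theorem measurable_accrued (k : Fin K) : Measurable fun ω : Driving K => accrued ω k :=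
  measurable_ncard_aliveSet.comp (f := fun ω : Driving K =>
    (ω.updateGap 0, ω.arrivalGap k, ω.lifespan k)) (by
      unfold Driving.updateGap Driving.arrivalGap Driving.lifespan; fun_prop)

theorem measurable_nextRewards (x : RewardState K) :
    Measurable fun ω : Driving K => nextRewards x ω := by
  refine measurable_pi_lambda _ fun k => (measurable_survivors x.1 k).add ?_
  split_ifs
  · exact measurable_accrued k
  · exact measurable_const

theorem measure_updateGap_lt_initialLifespan (k : Fin K) (j : ℕ) :
    M.drivingLaw {ω | ω.updateGap 0 < ω.initialLifespan k j} = ENNReal.ofReal M.survivalProb := by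
  have hs : MeasurableSet {p : ℝ × ℝ | p.1 < p.2} := measurableSet_lt measurable_fst measurable_snd
  have h := (M.measurePreserving_initialLifespan k j).measure_preimage hs.nullMeasurableSet
  refine h.trans ?_
  rw [Measure.prod_apply hs, survivalProb, ← lintegral_exp_neg_expMeasure M.beta_pos M.mu_pos]
  refine lintegral_congr_ae ?_
  filter_upwards [ae_pos_expMeasure M.beta_pos] with t ht
  rw [← expMeasure_Ioi M.mu_pos ht.le]
  rfl

theorem lintegral_survivors_le (q : Fin K → ℕ) (k : Fin K) :
    ∫⁻ ω, survivors q ω k ∂M.drivingLaw ≤ ENNReal.ofReal M.survivalProb * q k := by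
  have h1 : ∀ ω : Driving K, (survivors q ω k : ℝ≥0∞) ≤ ∑ j ∈ Finset.range (q k),
      {ω : Driving K | ω.updateGap 0 < ω.initialLifespan k j}.indicator 1 ω := by
    intro ω
    refine (natCast_ncard_le_tsum _).trans ?_
    rw [tsum_eq_sum (s := Finset.range (q k)) fun j hj => by
      rw [Set.indicator_of_notMem]; rintro ⟨h, -⟩; simp [h] at hj]
    refine Finset.sum_le_sum fun j _ => ?_
    simp only [Set.indicator, Set.mem_ofPred_eq, Pi.one_apply]
    split_ifs with h2 h3
    · exact le_rfl
    · exact absurd h2.2 h3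
    · exact zero_le
    · exact le_rfl
  have hs : ∀ j, MeasurableSet {ω : Driving K | ω.updateGap 0 < ω.initialLifespan k j} :=
    fun j => measurableSet_lt (by unfold Driving.updateGap; fun_prop)
      (by unfold Driving.initialLifespan; fun_prop)
  refine (lintegral_mono h1).trans ?_
  rw [lintegral_finsetSum _ fun j _ => measurable_one.indicator (hs j)]
  simp_rw [lintegral_indicator_one (hs _), measure_updateGap_lt_initialLifespan]
  simp [mul_comm]

theorem lintegral_comp_accrued (k : Fin K) (g : ℕ → ℝ≥0∞) :
    ∫⁻ ω, g (accrued ω k) ∂M.drivingLaw = ∫⁻ t, ∫⁻ p, g (aliveSet p.1 p.2 t).ncard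
      ∂((gapLaw (M.lam k)).prod (gapLaw M.mu)) ∂(expMeasure M.beta) := by
  have hg : Measurable fun p : ℝ × (ℕ → ℝ) × (ℕ → ℝ) => g (aliveSet p.2.1 p.2.2 p.1).ncard :=
    (measurable_from_top (f := g)).comp measurable_ncard_aliveSet
  exact ((M.measurePreserving_arrivals k).lintegral_comp hg).trans
    (lintegral_prod _ hg.aemeasurable)

theorem lintegral_accrued (k : Fin K) :
    ∫⁻ ω, accrued ω k ∂M.drivingLaw = ENNReal.ofReal (M.lam k / (M.beta + M.mu)) := by
  have hμ := M.mu_pos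
  have hβ := M.beta_pos
  have hl := M.lam_pos k
  rw [M.lintegral_comp_accrued k fun n => (n : ℝ≥0∞)]
  have h1 : ∀ t, ∫⁻ p, ((aliveSet p.1 p.2 t).ncard : ℝ≥0∞)
      ∂((gapLaw (M.lam k)).prod (gapLaw M.mu)) =
        ENNReal.ofReal (M.lam k) * ((ENNReal.ofReal M.mu)⁻¹ * expMeasure M.mu (Set.Iic t)) := by
    intro t
    rw [← lintegral_tsum_aliveSet hl hμ]
    refine lintegral_congr_ae ?_
    -- The mean number of points alive is finite, so that almost surely only finitely many are.
    have hfin : ∀ᵐ p ∂((gapLaw (M.lam k)).prod (gapLaw M.mu)),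
        ∑' j, (aliveSet p.1 p.2 t).indicator (fun _ => (1 : ℝ≥0∞)) j < ∞ := by
      refine ae_lt_top (Measurable.tsum fun j => measurable_aliveAt_arrival t j) ?_
      rw [lintegral_tsum_aliveSet hl hμ]
      exact ENNReal.mul_ne_top ENNReal.ofReal_ne_top (ENNReal.mul_ne_top
        (ENNReal.inv_ne_top.mpr (by simpa using hμ)) (measure_ne_top _ _))
    filter_upwards [hfin] with p hp
    exact natCast_ncard_eq_tsum hp.ne
  simp_rw [h1]
  have h2 : ∫⁻ t, expMeasure M.mu (Set.Iic t) ∂(expMeasure M.beta) =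
      1 - ENNReal.ofReal M.survivalProb := by
    have hpos := ae_pos_expMeasure hβ
    have h3 : ∫⁻ t, expMeasure M.mu (Set.Iic t) ∂(expMeasure M.beta) =
        ∫⁻ t, (1 - ENNReal.ofReal (Real.exp (-(M.mu * t)))) ∂(expMeasure M.beta) := by
      refine lintegral_congr_ae ?_
      filter_upwards [hpos] with t ht
      rw [← expMeasure_Ioi hμ ht.le, ← Set.compl_Ioi, prob_compl_eq_one_sub measurableSet_Ioi]
    have h4 := lintegral_exp_neg_expMeasure hβ hμ
    rw [h3, lintegral_sub' (by fun_prop) (by rw [h4]; exact ENNReal.ofReal_ne_top), h4]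
    · simp [survivalProb]
    · filter_upwards [hpos] with t ht
      rw [ENNReal.ofReal_le_one, Real.exp_le_one_iff]
      nlinarith
  have hm : Measurable fun t => expMeasure M.mu (Set.Iic t) :=
    Monotone.measurable fun s t hst => measure_mono (Set.Iic_subset_Iic.mpr hst)
  rw [lintegral_const_mul _ (hm.const_mul _), lintegral_const_mul _ hm, h2, ← ENNReal.ofReal_one,
    ← ENNReal.ofReal_sub _ M.survivalProb_pos.le, ← ENNReal.ofReal_inv_of_pos hμ,
    ← ENNReal.ofReal_mul (by positivity), ← ENNReal.ofReal_mul hl.le, survivalProb]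
  congr 1
  field_simp
  ring

theorem lintegral_accrued_sq_le (k : Fin K) :
    ∫⁻ ω, (accrued ω k : ℝ≥0∞) ^ 2 ∂M.drivingLaw ≤
      ENNReal.ofReal (M.lam k / M.mu + (M.lam k / M.mu) ^ 2) := by
  have hμ := M.mu_pos
  have hl := M.lam_pos k
  rw [M.lintegral_comp_accrued k fun n => (n : ℝ≥0∞) ^ 2]
  have h1 : ∀ t, ∫⁻ p, ((aliveSet p.1 p.2 t).ncard : ℝ≥0∞) ^ 2
      ∂((gapLaw (M.lam k)).prod (gapLaw M.mu)) ≤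
        ENNReal.ofReal (M.lam k / M.mu + (M.lam k / M.mu) ^ 2) := by
    intro t
    refine (lintegral_mono fun p => pow_le_pow_left₀ (zero_le) (natCast_ncard_le_tsum _) 2).trans
      ((lintegral_tsum_aliveSet_sq_le hl hμ t).trans_eq ?_)
    rw [← ENNReal.ofReal_inv_of_pos hμ, ← ENNReal.ofReal_mul hl.le, ← ENNReal.ofReal_pow
      (by positivity), ← ENNReal.ofReal_add (by positivity) (by positivity), div_eq_mul_inv]
  refine (lintegral_mono h1).trans ?_
  simp

/-- The number of accrued rewards is close to `lam k / mu` in mean square, hence in mean, when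
updates are rare. -/
theorem integral_abs_accrued_sub_le (k : Fin K) :
    Integrable (fun ω => |(accrued ω k : ℝ) - M.lam k / M.mu|) M.drivingLaw ∧
    ∫ ω, |(accrued ω k : ℝ) - M.lam k / M.mu| ∂M.drivingLaw ≤
      √(M.lam k / M.mu + 2 * (M.lam k / M.mu) ^ 2 * M.survivalProb) := by
  have hμ := M.mu_pos
  have hβ := M.beta_pos
  have hl := M.lam_pos k
  set L := M.lam k / M.mu with hL
  have hL0 : 0 < L := by positivity
  have hNm : Measurable fun ω : Driving K => (accrued ω k : ℝ) :=
    (measurable_from_top (f := fun n : ℕ => (n : ℝ))).comp (measurable_accrued k)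
  have hof : ∀ n : ℕ, ENNReal.ofReal ((n : ℝ) ^ 2) = (n : ℝ≥0∞) ^ 2 := fun n => by
    rw [ENNReal.ofReal_pow (by positivity), ENNReal.ofReal_natCast]
  have hsqint : Integrable (fun ω => (accrued ω k : ℝ) ^ 2) M.drivingLaw := by
    refine ⟨(hNm.pow_const 2).aestronglyMeasurable, ?_⟩
    rw [hasFiniteIntegral_iff_ofReal (Eventually.of_forall fun ω => by positivity)]
    simp_rw [hof]
    exact (M.lintegral_accrued_sq_le k).trans_lt ENNReal.ofReal_lt_top
  have hmem : MemLp (fun ω => (accrued ω k : ℝ)) 2 M.drivingLaw :=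
    (memLp_two_iff_integrable_sq hNm.aestronglyMeasurable).mpr hsqint
  have hint : Integrable (fun ω => (accrued ω k : ℝ)) M.drivingLaw := hmem.integrable one_le_two
  have hmean : ∫ ω, (accrued ω k : ℝ) ∂M.drivingLaw = M.lam k / (M.beta + M.mu) := by
    rw [integral_eq_lintegral_of_nonneg_ae (Eventually.of_forall fun ω => by positivity)
      hNm.aestronglyMeasurable]
    simp_rw [ENNReal.ofReal_natCast]
    rw [M.lintegral_accrued k, ENNReal.toReal_ofReal (by positivity)]
  have hsq : ∫ ω, (accrued ω k : ℝ) ^ 2 ∂M.drivingLaw ≤ L + L ^ 2 := by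
    rw [integral_eq_lintegral_of_nonneg_ae (Eventually.of_forall fun ω => by positivity)
      (hNm.pow_const 2).aestronglyMeasurable]
    simp_rw [hof]
    exact ENNReal.toReal_le_of_le_ofReal (by positivity) (M.lintegral_accrued_sq_le k)
  have hmem' : MemLp (fun ω => |(accrued ω k : ℝ) - L|) 2 M.drivingLaw :=
    (hmem.sub (memLp_const L)).abs
  refine ⟨hmem'.integrable one_le_two, Real.le_sqrt_of_sq_le ?_⟩
  -- The square of the mean is at most the mean of the square.
  have hvar := variance_nonneg (fun ω => |(accrued ω k : ℝ) - L|) M.drivingLaw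
  rw [variance_eq_sub hmem'] at hvar
  have h1 : ∫ ω, (|(accrued ω k : ℝ) - L|) ^ 2 ∂M.drivingLaw =
      ∫ ω, (accrued ω k : ℝ) ^ 2 ∂M.drivingLaw - 2 * L * (M.lam k / (M.beta + M.mu)) + L ^ 2 := by
    rw [← hmean, ← integral_const_mul, ← integral_sub hsqint (hint.const_mul _)]
    have : ∫ ω, ((accrued ω k : ℝ) ^ 2 - 2 * L * (accrued ω k : ℝ)) ∂M.drivingLaw + L ^ 2 =
        ∫ ω, ((accrued ω k : ℝ) ^ 2 - 2 * L * (accrued ω k : ℝ) + L ^ 2) ∂M.drivingLaw := by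
      rw [integral_add (f := fun ω => (accrued ω k : ℝ) ^ 2 - 2 * L * (accrued ω k : ℝ))
        (hsqint.sub (hint.const_mul _)) (integrable_const _)]
      simp
    rw [this]
    refine integral_congr_ae (Eventually.of_forall fun ω => ?_)
    simp only [sq_abs]
    ring
  have h2 : L + L ^ 2 - 2 * L * (M.lam k / (M.beta + M.mu)) + L ^ 2 =
      L + 2 * L ^ 2 * M.survivalProb := by
    rw [hL, survivalProb]
    field_simp
    ring
  simp only [Pi.pow_apply] at hvar
  rw [h1] at hvar
  linarith

end RewardModel

/-! ### Sampling from weights -/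

section Sampling

variable {K : ℕ} [NeZero K]

theorem measurable_sampleWeights (w : Fin K → ℝ) :
    Measurable fun u : unitInterval => sampleWeights w u := by
  have h : Measurable fun u : unitInterval =>
      {k : Fin K | (u : ℝ) * ∑ i, w i ≤ ∑ i ∈ Finset.Iic k, w i} :=
    measurable_set_iff.mpr fun k => measurableSet_setOfPred.mp
      (measurableSet_le (measurable_subtype_coe.mul_const _) measurable_const)
  exact (Measurable.of_discrete (f := fun s : Set (Fin K) => sInf s)).comp h

theorem sampleWeights_eq_of_lt_of_le {w : Fin K → ℝ} (hw : ∀ i, 0 < w i) {u : ℝ} {i : Fin K}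
    (h₁ : ∑ j ∈ Finset.Iio i, w j < u * ∑ j, w j)
    (h₂ : u * ∑ j, w j ≤ ∑ j ∈ Finset.Iic i, w j) : sampleWeights w u = i := by
  refine IsLeast.csInf_eq ⟨h₂, fun j hj => ?_⟩
  by_contra hij
  have hsub : Finset.Iic j ⊆ Finset.Iio i := fun l hl =>
    Finset.mem_Iio.mpr ((Finset.mem_Iic.mp hl).trans_lt (not_le.mp hij))
  exact absurd (h₁.trans_le hj) (not_lt.mpr (Finset.sum_le_sum_of_subset_of_nonneg hsub
    fun l _ _ => (hw l).le))

/-- Sampling by inversion gives each `i` the probability `w i / ∑ j, w j`. It suffices to prove `≥`,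
as both sides sum to `1`. -/
theorem measure_sampleWeights {w : Fin K → ℝ} (hw : ∀ i, 0 < w i) (i : Fin K) :
    (volume : Measure unitInterval).real {u | sampleWeights w u = i} = w i / ∑ j, w j := by
  have hpos : 0 < ∑ j, w j := Finset.sum_pos (fun j _ => hw j) Finset.univ_nonempty
  have hge : ∀ i, w i / ∑ j, w j ≤
      (volume : Measure unitInterval).real {u | sampleWeights w u = i} := by
    intro i
    have hsplit : ∑ j ∈ Finset.Iic i, w j = ∑ j ∈ Finset.Iio i, w j + w i := by
      rw [← Finset.Iio_insert, Finset.sum_insert (by simp), add_comm]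
    have ha : 0 ≤ ∑ j ∈ Finset.Iio i, w j := Finset.sum_nonneg fun j _ => (hw j).le
    have hb : ∑ j ∈ Finset.Iic i, w j ≤ ∑ j, w j :=
      Finset.sum_le_sum_of_subset_of_nonneg (Finset.subset_univ _) fun l _ _ => (hw l).le
    set a : unitInterval := ⟨(∑ j ∈ Finset.Iio i, w j) / ∑ j, w j, by positivity,
      (div_le_one hpos).mpr (by linarith [hw i])⟩ with hadef
    set b : unitInterval := ⟨(∑ j ∈ Finset.Iic i, w j) / ∑ j, w j,
      div_nonneg (by linarith [hw i]) hpos.le, (div_le_one hpos).mpr hb⟩ with hbdef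
    have hsub : Set.Ioc a b ⊆ {u : unitInterval | sampleWeights w u = i} := by
      rintro u ⟨h1, h2⟩
      exact sampleWeights_eq_of_lt_of_le hw ((div_lt_iff₀ hpos).mp h1) ((le_div_iff₀ hpos).mp h2)
    refine le_trans (le_of_eq ?_) (measureReal_mono hsub)
    rw [measureReal_def, unitInterval.volume_Ioc, ENNReal.toReal_ofReal]
    · simp only [hadef, hbdef, hsplit]; ring
    · simp only [hadef, hbdef, hsplit, sub_nonneg]; gcongr; linarith [hw i]
  have hsum : ∑ i, (volume : Measure unitInterval).real {u | sampleWeights w u = i} = 1 := by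
    have := sum_measureReal_preimage_singleton (μ := (volume : Measure unitInterval))
      (f := fun u : unitInterval => sampleWeights w u) Finset.univ
      (fun i _ => measurable_sampleWeights w (measurableSet_singleton i))
    exact this.trans (by simp)
  have hsum' : ∑ i, w i / ∑ j, w j = 1 := by rw [← Finset.sum_div, div_self hpos.ne']
  exact ((Finset.sum_eq_sum_iff_of_le fun i _ => hge i).mp (hsum'.trans hsum.symm) i
    (Finset.mem_univ i)).symm

/-- The probability of `i` in the distribution proportional to the weights `max (q k) α`. -/
noncomputable def matchProb {K : ℕ} (α : ℝ) (q : Fin K → ℝ) (i : Fin K) : ℝ :=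
  max (q i) α / ∑ j, max (q j) α


theorem sum_max_pos {α : ℝ} (hα : 0 < α) (q : Fin K → ℝ) : 0 < ∑ j, max (q j) α :=
  Finset.sum_pos (fun _ _ => lt_max_of_lt_right hα) Finset.univ_nonempty

theorem matchProb_nonneg {α : ℝ} (hα : 0 < α) (q : Fin K → ℝ) (i : Fin K) :
    0 ≤ matchProb α q i :=
  div_nonneg (le_max_of_le_right hα.le) (sum_max_pos hα q).le

theorem matchProb_le_one {α : ℝ} (hα : 0 < α) (q : Fin K → ℝ) (i : Fin K) :
    matchProb α q i ≤ 1 := by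
  rw [matchProb, div_le_one (sum_max_pos hα q)]
  exact Finset.single_le_sum (f := fun j => max (q j) α) (fun j _ => le_max_of_le_right hα.le)
    (Finset.mem_univ i)

/-- The matching probabilities are Lipschitz continuous in the rewards. -/
theorem abs_matchProb_sub_le {α : ℝ} (hα : 0 < α) (q q' : Fin K → ℝ) (i : Fin K) :
    |matchProb α q i - matchProb α q' i| ≤ 2 / α * ∑ j, |q j - q' j| := by
  set s := ∑ j, max (q j) α with hs
  set s' := ∑ j, max (q' j) α with hs'
  have hs0 : 0 < s := sum_max_pos hα q
  have hs0' : 0 < s' := sum_max_pos hα q'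
  set d := ∑ j, |q j - q' j| with hd
  have hmax : ∀ j, |max (q j) α - max (q' j) α| ≤ |q j - q' j| := fun j =>
    abs_max_sub_max_le_abs _ _ _
  have hi : |max (q i) α - max (q' i) α| ≤ d := (hmax i).trans
    (Finset.single_le_sum (f := fun j => |q j - q' j|) (fun j _ => abs_nonneg _)
      (Finset.mem_univ i))
  have hss : |s' - s| ≤ d := by
    rw [abs_sub_comm, hs, hs', ← Finset.sum_sub_distrib]
    exact (Finset.abs_sum_le_sum_abs _ _).trans (Finset.sum_le_sum fun j _ => hmax j)
  have hαs : α ≤ s := (le_max_right (q i) α).trans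
    (Finset.single_le_sum (f := fun j => max (q j) α) (fun j _ => le_max_of_le_right hα.le)
      (Finset.mem_univ i))
  have hp := matchProb_nonneg hα q' i
  have hp1 := matchProb_le_one hα q' i
  have hd0 : 0 ≤ d := Finset.sum_nonneg fun j _ => abs_nonneg _
  have hkey : matchProb α q i - matchProb α q' i =
      (max (q i) α - max (q' i) α + matchProb α q' i * (s' - s)) / s := by
    rw [matchProb, matchProb, ← hs, ← hs']
    field_simp
    ring
  rw [hkey, abs_div, abs_of_pos hs0, div_le_iff₀ hs0]
  calc |max (q i) α - max (q' i) α + matchProb α q' i * (s' - s)|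
      ≤ |max (q i) α - max (q' i) α| + |matchProb α q' i * (s' - s)| := abs_add_le _ _
    _ ≤ d + 1 * d := by
        rw [abs_mul, abs_of_nonneg hp]
        gcongr
    _ = 2 / α * d * α := by field_simp; ring
    _ ≤ 2 / α * d * s := by gcongr

end Sampling

/-! ### The transition kernel of the embedded chain -/

namespace RewardModel

open PoissonProcess

variable {K : ℕ} [NeZero K] (M : RewardModel K)

theorem measurable_newChoice :
    Measurable fun p : (Fin K → ℕ) × unitInterval => M.newChoice p.1 p.2 :=
  measurable_from_prod_countable_right fun q =>
    measurable_sampleWeights fun k => max (q k : ℝ) M.alpha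

theorem measurable_step (x : RewardState K) : Measurable fun ω : Driving K => M.step x ω := by
  have hu : Measurable fun ω : Driving K => ω.2.1 0 :=
    (measurable_pi_apply 0).comp (measurable_fst.comp measurable_snd)
  have h : Measurable fun ω : Driving K => M.newChoice (nextRewards x ω) (ω.unif 0) :=
    M.measurable_newChoice.comp (f := fun ω : Driving K => (nextRewards x ω, ω.2.1 0))
      ((measurable_nextRewards x).prodMk hu)
  exact (measurable_nextRewards x).prodMk h

theorem measurable_step_uncurry :
    Measurable fun p : RewardState K × Driving K => M.step p.1 p.2 :=
  measurable_from_prod_countable_right fun x => M.measurable_step x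

/-- The transition kernel of the embedded chain. -/
noncomputable def stepKernel : Kernel (RewardState K) (RewardState K) where
  toFun x := M.drivingLaw.map (M.step x)
  measurable' := measurable_of_countable _

theorem stepKernel_apply (x : RewardState K) : M.stepKernel x = M.drivingLaw.map (M.step x) := rfl

instance : IsMarkovKernel M.stepKernel :=
  ⟨fun x => Measure.isProbabilityMeasure_map (M.measurable_step x).aemeasurable⟩

variable (π : Measure (RewardState K))

/-- Almost surely all gaps are positive, and then the chain makes the step described by `step`, from
the choice of the initial state. -/
theorem ae_embedded_eq [IsProbabilityMeasure π] : ∀ᵐ p ∂(M.startedFrom π),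
    M.embedded p.1 p.2 1 = M.step p.1 p.2 ∧ (M.embedded p.1 p.2 0).2 = p.1.2 := by
  have h : Measure.QuasiMeasurePreserving (Prod.snd : RewardState K × Driving K → Driving K)
      (M.startedFrom π) M.drivingLaw := Measure.quasiMeasurePreserving_snd
  filter_upwards [h.ae M.ae_updateGap_pos, h.ae M.ae_arrivalGap_pos] with p hτ ha
  exact ⟨M.embedded_one_eq_step hτ ha p.1, M.embedded_zero_snd hτ p.1⟩

theorem map_step_eq_bind [IsProbabilityMeasure π] :
    (M.startedFrom π).map (fun p => M.step p.1 p.2) = π.bind M.stepKernel := by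
  refine Measure.ext fun s hs => ?_
  rw [Measure.map_apply M.measurable_step_uncurry hs, startedFrom,
    Measure.prod_apply (M.measurable_step_uncurry hs),
    Measure.bind_apply hs M.stepKernel.measurable.aemeasurable]
  refine lintegral_congr fun x => ?_
  rw [stepKernel_apply, Measure.map_apply (M.measurable_step x) hs]
  rfl

theorem isStationary_iff :
    M.IsStationary π ↔ IsProbabilityMeasure π ∧ M.stepKernel.Invariant π := by
  have key : ∀ [IsProbabilityMeasure π],
      (M.startedFrom π).map (fun p => M.embedded p.1 p.2 1) = π.bind M.stepKernel := by
    intro _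
    rw [← map_step_eq_bind]
    exact Measure.map_congr ((M.ae_embedded_eq π).mono fun p hp => hp.1)
  constructor
  · rintro ⟨h1, h2⟩
    exact ⟨h1, by rw [Kernel.Invariant, ← key, h2]⟩
  · rintro ⟨h1, h2⟩
    exact ⟨h1, by rw [key, h2.def]⟩

/-! ### Accessibility of the empty state, and the drift towards it -/

/-- With positive probability the first update period lies in `(1, 2]`, no reward occurs before
time `2`, all initial rewards are gone by time `1`, and the new choice is `0`. -/
theorem stepKernel_empty_ne_zero (x : RewardState K) : M.stepKernel x {(0, 0)} ≠ 0 := by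
  classical
  set A : Set (ℕ → ℝ) := (fun τ => τ 0) ⁻¹' Set.Ioc 1 2 with hA
  set B : Set (ℕ → unitInterval) := (fun v => v 0) ⁻¹' {u | M.newChoice 0 u = 0} with hB
  set G : Set (Fin K × ℕ → ℝ) := (fun a => a (x.2, 0)) ⁻¹' Set.Ioi 2 with hG
  set R : Set (Fin K × ℕ → ℝ) :=
    Set.pi ((Finset.univ.sigma fun k => Finset.range (x.1 k)).image fun p => (p.1, p.2) :
      Finset (Fin K × ℕ)) fun _ => Set.Iic 1 with hR
  have hApos : Measure.infinitePi (fun _ : ℕ => expMeasure M.beta) A ≠ 0 := by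
    rw [hA, (measurePreserving_eval_infinitePi (fun _ : ℕ => expMeasure M.beta) 0).measure_preimage
      measurableSet_Ioc.nullMeasurableSet, ← Set.Iic_sdiff_Iic, measure_sdiff
      (Set.Iic_subset_Iic.mpr (by norm_num)) measurableSet_Iic.nullMeasurableSet
      (measure_ne_top _ _), expMeasure_Iic M.beta_pos, expMeasure_Iic M.beta_pos]
    have h1 : Real.exp (-(M.beta * 2)) < Real.exp (-(M.beta * 1)) := by
      rw [Real.exp_lt_exp]; linarith [M.beta_pos]
    refine (tsub_pos_of_lt ?_).ne'
    rw [if_pos (by norm_num), if_pos (by norm_num)]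
    refine (ENNReal.ofReal_lt_ofReal_iff ?_).mpr (by linarith)
    rw [sub_pos, Real.exp_lt_one_iff]
    linarith [M.beta_pos]
  have hBpos : Measure.infinitePi (fun _ : ℕ => (volume : Measure unitInterval)) B ≠ 0 := by
    have hw : ∀ k : Fin K, 0 < max (((0 : Fin K → ℕ) k : ℕ) : ℝ) M.alpha :=
      fun k => lt_max_of_lt_right M.alpha_pos
    have hm : MeasurableSet {u : unitInterval | M.newChoice (0 : Fin K → ℕ) u = 0} :=
      measurable_sampleWeights (fun k => max (((0 : Fin K → ℕ) k : ℕ) : ℝ) M.alpha)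
        (measurableSet_singleton 0)
    rw [hB, (measurePreserving_eval_infinitePi
      (fun _ : ℕ => (volume : Measure unitInterval)) 0).measure_preimage hm.nullMeasurableSet]
    intro h0
    have h1 := measure_sampleWeights hw 0
    have h2 : (volume : Measure unitInterval).real {u | M.newChoice (0 : Fin K → ℕ) u = 0} = 0 := by
      rw [measureReal_def, h0, ENNReal.toReal_zero]
    have h3 : 0 < max (((0 : Fin K → ℕ) 0 : ℕ) : ℝ) M.alpha /
        ∑ k : Fin K, max (((0 : Fin K → ℕ) k : ℕ) : ℝ) M.alpha :=
      div_pos (hw 0) (Finset.sum_pos (fun j _ => hw j) Finset.univ_nonempty)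
    exact h3.ne' (h1.symm.trans h2)
  have hGpos : Measure.infinitePi (fun p : Fin K × ℕ => expMeasure (M.lam p.1)) G ≠ 0 := by
    rw [hG, (measurePreserving_eval_infinitePi (fun p : Fin K × ℕ => expMeasure (M.lam p.1))
      (x.2, 0)).measure_preimage measurableSet_Ioi.nullMeasurableSet]
    exact (expMeasure_Ioi_pos (M.lam_pos x.2) (by norm_num)).ne'
  have hRpos : Measure.infinitePi (fun _ : Fin K × ℕ => expMeasure M.mu) R ≠ 0 := by
    rw [hR, Measure.infinitePi_pi _ fun _ _ => measurableSet_Iic]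
    exact Finset.prod_ne_zero_iff.mpr fun _ _ => (expMeasure_Iic_pos M.mu_pos one_pos).ne'
  have hpos : M.drivingLaw (A ×ˢ (B ×ˢ (G ×ˢ ((Set.univ : Set (Fin K × ℕ → ℝ)) ×ˢ R)))) ≠ 0 := by
    rw [drivingLaw_eq, rewardLaw, Measure.prod_prod, Measure.prod_prod, Measure.prod_prod,
      Measure.prod_prod, measure_univ, one_mul]
    exact mul_ne_zero hApos (mul_ne_zero hBpos (mul_ne_zero hGpos hRpos))
  rw [stepKernel_apply, Measure.map_apply (M.measurable_step x) (measurableSet_singleton _)]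
  refine fun h0 => hpos (measure_mono_null_ae ?_ h0)
  filter_upwards [M.ae_arrivalGap_pos] with ω ha
  rintro ⟨hτ, hv, hg, -, hr⟩
  have h1 : nextRewards x ω = 0 := by
    funext k
    have hs : survivors x.1 ω k = 0 := by
      refine (congrArg Set.ncard (Set.eq_empty_of_forall_notMem ?_)).trans (Set.ncard_empty ℕ)
      rintro j ⟨hj, hlt⟩
      have h2 : ω.initialLifespan k j ≤ 1 := hr (k, j) (by simpa using hj)
      exact absurd hlt (not_lt.mpr (h2.trans hτ.1.le))
    have hacc : x.2 = k → accrued ω k = 0 := by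
      rintro rfl
      refine (congrArg Set.ncard (Set.eq_empty_of_forall_notMem ?_)).trans (Set.ncard_empty ℕ)
      rintro j ⟨hj, -⟩
      have h2 : ω.arrivalGap x.2 0 ≤ arrival (ω.arrivalGap x.2) j :=
        Finset.single_le_sum (f := fun i => ω.arrivalGap x.2 i) (fun i _ => (ha x.2 i).le)
          (Finset.mem_range.mpr (Nat.succ_pos j))
      have h3 : 2 < ω.arrivalGap x.2 0 := hg
      exact absurd (h2.trans (hj.trans hτ.2)) (not_le.mpr h3)
    rw [nextRewards, hs]
    split_ifs with hk
    · rw [hacc hk]; rfl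
    · rfl
  change M.step x ω = (0, 0)
  rw [step, h1]
  exact Prod.ext rfl hv

/-- The total number of rewards. -/
def totalRewards {K : ℕ} (x : RewardState K) : ℕ := ∑ k, x.1 k

theorem finite_totalRewards_le {K : ℕ} (R : ℕ) :
    {x : RewardState K | totalRewards x ≤ R}.Finite := by
  refine ((Set.finite_Iic (fun _ : Fin K => R)).prod Set.finite_univ).subset ?_
  rintro ⟨q, c⟩ hx
  refine ⟨fun k => (Finset.single_le_sum (f := fun k => q k) (fun _ _ => Nat.zero_le _)
    (Finset.mem_univ k)).trans hx, trivial⟩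

theorem lintegral_totalRewards_le (x : RewardState K) :
    ∫⁻ y, totalRewards y ∂(M.stepKernel x) ≤
      ENNReal.ofReal M.survivalProb * totalRewards x + ENNReal.ofReal ((∑ k, M.lam k) / M.mu) := by
  have hβ := M.beta_pos
  have hμ := M.mu_pos
  rw [stepKernel_apply, lintegral_map (measurable_of_countable _) (M.measurable_step x)]
  have h1 : ∀ ω : Driving K, (totalRewards (M.step x ω) : ℝ≥0∞) =
      ∑ k, (survivors x.1 ω k : ℝ≥0∞) + accrued ω x.2 := by
    intro ω
    simp [totalRewards, step, nextRewards, Finset.sum_add_distrib]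
  have hm : ∀ {f : Driving K → ℕ}, Measurable f → Measurable fun ω => (f ω : ℝ≥0∞) := fun hf =>
    (measurable_from_top (f := fun n : ℕ => (n : ℝ≥0∞))).comp hf
  simp_rw [h1]
  rw [lintegral_add_right _ (hm (measurable_accrued x.2)),
    lintegral_finsetSum _ fun k _ => hm (measurable_survivors x.1 k), lintegral_accrued]
  refine add_le_add ?_ (ENNReal.ofReal_le_ofReal ?_)
  · refine (Finset.sum_le_sum fun k _ => M.lintegral_survivors_le x.1 k).trans_eq ?_
    rw [← Finset.mul_sum]
    simp [totalRewards]
  · have : M.lam x.2 ≤ ∑ k, M.lam k := Finset.single_le_sum (f := M.lam)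
      (fun k _ => (M.lam_pos k).le) (Finset.mem_univ _)
    have h0 := M.lam_pos x.2
    exact div_le_div₀ (h0.le.trans this) this hμ (le_add_of_nonneg_left hβ.le)

theorem existsUnique_isStationary : ∃! π : Measure (RewardState K), M.IsStationary π := by
  obtain ⟨π, hπ, hinv⟩ := MarkovChain.exists_invariant_of_drift M.stepKernel
    (M.stepKernel_empty_ne_zero) (measurable_of_countable totalRewards) finite_totalRewards_le
    (ENNReal.ofReal_lt_one.mpr M.survivalProb_lt_one) ENNReal.ofReal_ne_top
    M.lintegral_totalRewards_le
  refine ⟨π, (M.isStationary_iff π).mpr ⟨hπ, hinv⟩, fun π' hπ' => ?_⟩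
  obtain ⟨h1, h2⟩ := (M.isStationary_iff π').mp hπ'
  exact MarkovChain.invariant_unique M.stepKernel M.stepKernel_empty_ne_zero h2 hinv

variable {M π}

/-- The mean number of rewards under the stationary distribution. -/
theorem IsStationary.integral_totalRewards_le (hπ : M.IsStationary π) :
    Integrable (fun x => (totalRewards x : ℝ)) π ∧
    ∫ x, (totalRewards x : ℝ) ∂π ≤ (∑ k, M.lam k) / M.mu / (1 - M.survivalProb) := by
  obtain ⟨h1, h2⟩ := (M.isStationary_iff π).mp hπ
  have hlam : 0 ≤ ∑ k, M.lam k := Finset.sum_nonneg fun k _ => (M.lam_pos k).le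
  have hμ := M.mu_pos
  have hρ := M.survivalProb_lt_one
  have hb : ∫⁻ x, totalRewards x ∂π ≤
      ENNReal.ofReal ((∑ k, M.lam k) / M.mu / (1 - M.survivalProb)) := by
    refine (MarkovChain.lintegral_le_of_drift h2 (measurable_of_countable _)
      (fun x => ENNReal.natCast_ne_top _) (ENNReal.ofReal_lt_one.mpr M.survivalProb_lt_one)
      M.lintegral_totalRewards_le).trans_eq ?_
    rw [ENNReal.ofReal_div_of_pos (y := 1 - M.survivalProb) (by linarith),
      ENNReal.ofReal_sub _ M.survivalProb_pos.le,
      ENNReal.ofReal_one]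
  have hm : Measurable fun x : RewardState K => (totalRewards x : ℝ) := measurable_of_countable _
  constructor
  · refine ⟨hm.aestronglyMeasurable, ?_⟩
    rw [hasFiniteIntegral_iff_ofReal (Eventually.of_forall fun ω => by positivity)]
    simp_rw [ENNReal.ofReal_natCast]
    exact hb.trans_lt ENNReal.ofReal_lt_top
  · rw [integral_eq_lintegral_of_nonneg_ae (Eventually.of_forall fun ω => by positivity)
      hm.aestronglyMeasurable]
    simp_rw [ENNReal.ofReal_natCast]
    exact ENNReal.toReal_le_of_le_ofReal (div_nonneg (by positivity) (by linarith)) hb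

end RewardModel

/-! ### The choice transition probabilities -/

namespace RewardModel

variable {K : ℕ} [NeZero K] (M : RewardModel K)

/-- Integrating out a factor of a threefold product on which the integrand depends through `f`. -/
theorem lintegral_prod_prod_eq {α β γ δ : Type*} [MeasurableSpace α] [MeasurableSpace β]
    [MeasurableSpace γ] [MeasurableSpace δ] {μ : Measure α} {ν : Measure β} {ρ : Measure γ}
    {η : Measure δ} [SFinite μ] [IsProbabilityMeasure ν] [SFinite ρ] [SFinite η] {f : β → δ}
    (hf : MeasurePreserving f ν η) {H : α × γ → δ → ℝ≥0∞}
    (hH : Measurable fun p : (α × γ) × δ => H p.1 p.2) :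
    ∫⁻ p, H (p.1, p.2.2) (f p.2.1) ∂(μ.prod (ν.prod ρ)) =
      ∫⁻ p, ∫⁻ d, H (p.1, p.2.2) d ∂η ∂(μ.prod (ν.prod ρ)) := by
  have hpr : Measurable fun p : α × β × γ => (p.1, p.2.2) := by fun_prop
  have hm1 : Measurable fun p : α × β × γ => H (p.1, p.2.2) (f p.2.1) :=
    hH.comp (hpr.prodMk (hf.measurable.comp (measurable_fst.comp measurable_snd)))
  have hm2 : Measurable fun p : α × β × γ => ∫⁻ d, H (p.1, p.2.2) d ∂η :=
    hH.lintegral_prod_right'.comp hpr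
  rw [lintegral_prod _ hm1.aemeasurable, lintegral_prod _ hm2.aemeasurable]
  refine lintegral_congr fun a => ?_
  have hm3 : Measurable fun y : β × γ => H (a, y.2) (f y.1) := hm1.comp measurable_prodMk_left
  have hm4 : Measurable fun y : β × γ => ∫⁻ d, H (a, y.2) d ∂η := hm2.comp measurable_prodMk_left
  rw [lintegral_prod_symm _ hm3.aemeasurable, lintegral_prod_symm _ hm4.aemeasurable]
  refine lintegral_congr fun c => ?_
  have hsec : Measurable fun d => H (a, c) d := hH.comp measurable_prodMk_left
  refine (hf.lintegral_comp hsec).trans ?_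
  simp

/-- The sampling variable is independent of the rewards at the first update point. -/
theorem lintegral_nextRewards_unif {K : ℕ} (M : RewardModel K) (x : RewardState K)
    (F : (Fin K → ℕ) → unitInterval → ℝ≥0∞)
    (hF : Measurable fun p : (Fin K → ℕ) × unitInterval => F p.1 p.2) :
    ∫⁻ ω, F (nextRewards x ω) (ω.2.1 0) ∂M.drivingLaw =
      ∫⁻ ω, ∫⁻ u, F (nextRewards x ω) u ∂(volume : Measure unitInterval) ∂M.drivingLaw := by
  -- The rewards do not depend on the sampling variables, which may be replaced by any others.
  let N : (ℕ → ℝ) × (Fin K × ℕ → ℝ) × (Fin K × ℕ → ℝ) × (Fin K × ℕ → ℝ) → Fin K → ℕ :=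
    fun z => nextRewards x ((z.1, fun _ => 0, z.2) : Driving K)
  have hN : ∀ ω : Driving K, nextRewards x ω = N (ω.1, ω.2.2) := by
    intro ω
    funext k
    simp only [N, nextRewards, survivors, accrued]
  have hNm : Measurable N := (measurable_nextRewards x).comp
    (measurable_fst.prodMk (measurable_const.prodMk measurable_snd))
  simp_rw [hN]
  exact lintegral_prod_prod_eq
    (measurePreserving_eval_infinitePi (fun _ : ℕ => (volume : Measure unitInterval)) 0)
    (H := fun z u => F (N z) u)
    (hF.comp ((hNm.comp measurable_fst).prodMk measurable_snd))

theorem integrable_matchProb (x : RewardState K) (i : Fin K) :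
    Integrable (fun ω => matchProb M.alpha (fun k => (nextRewards x ω k : ℝ)) i) M.drivingLaw := by
  refine Integrable.of_bound (C := 1) ?_ (Eventually.of_forall fun ω => ?_)
  · exact ((measurable_of_countable fun q : Fin K → ℕ =>
      matchProb M.alpha (fun k => (q k : ℝ)) i).comp
        (measurable_nextRewards x)).aestronglyMeasurable
  · rw [Real.norm_eq_abs, abs_of_nonneg (matchProb_nonneg M.alpha_pos _ _)]
    exact matchProb_le_one M.alpha_pos _ _

/-- The probability that the next choice is `i` is the mean of the matching probability of `i`. -/
theorem measureReal_step_snd (x : RewardState K) (i : Fin K) :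
    M.drivingLaw.real {ω | (M.step x ω).2 = i} =
      ∫ ω, matchProb M.alpha (fun k => (nextRewards x ω k : ℝ)) i ∂M.drivingLaw := by
  have hms : MeasurableSet {ω : Driving K | (M.step x ω).2 = i} :=
    (measurable_snd.comp (M.measurable_step x)) (measurableSet_singleton i)
  have h := M.lintegral_nextRewards_unif x
    (fun q u => ({p : (Fin K → ℕ) × unitInterval | M.newChoice p.1 p.2 = i}).indicator 1 (q, u))
    (measurable_one.indicator (M.measurable_newChoice (measurableSet_singleton i)))
  have h1 : ∀ q : Fin K → ℕ, ∫⁻ u, ({p : (Fin K → ℕ) × unitInterval |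
      M.newChoice p.1 p.2 = i}).indicator 1 (q, u) ∂(volume : Measure unitInterval) =
        ENNReal.ofReal (matchProb M.alpha (fun k => (q k : ℝ)) i) := by
    intro q
    have hs : MeasurableSet {u : unitInterval | M.newChoice q u = i} :=
      measurable_sampleWeights (fun k => max (q k : ℝ) M.alpha) (measurableSet_singleton i)
    have hw : ∀ k : Fin K, 0 < max (q k : ℝ) M.alpha := fun k => lt_max_of_lt_right M.alpha_pos
    rw [matchProb, ← measure_sampleWeights hw i, ofReal_measureReal]
    exact lintegral_indicator_one hs
  simp_rw [h1] at h
  rw [integral_eq_lintegral_of_nonneg_ae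
    (Eventually.of_forall fun ω => matchProb_nonneg M.alpha_pos _ _)
    (M.integrable_matchProb x i).aestronglyMeasurable, ← h, measureReal_def,
    ← lintegral_indicator_one hms]
  rfl

/-- The rewards that action `k` alone yields in the long run. -/
noncomputable def steadyRewards (k : Fin K) : Fin K → ℝ :=
  fun i => if k = i then M.lam k / M.mu else 0

/-- The next choice from a state with current choice `k` is made nearly as if there were
`lam k / mu` rewards of action `k` and no others: few initial rewards survive, and the number of
accrued rewards concentrates. -/
theorem abs_measureReal_step_snd_sub_le (x : RewardState K) (i : Fin K) :
    |M.drivingLaw.real {ω | (M.step x ω).2 = i} - matchProb M.alpha (M.steadyRewards x.2) i| ≤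
      2 / M.alpha * (M.survivalProb * totalRewards x +
        √(M.lam x.2 / M.mu + 2 * (M.lam x.2 / M.mu) ^ 2 * M.survivalProb)) := by
  have hα := M.alpha_pos
  have hρ := M.survivalProb_pos
  have hsm : ∀ k, Measurable fun ω : Driving K => (survivors x.1 ω k : ℝ) := fun k =>
    (measurable_from_top (f := fun n : ℕ => (n : ℝ))).comp (measurable_survivors x.1 k)
  have hsb : ∀ k, ∫⁻ ω, ENNReal.ofReal (survivors x.1 ω k) ∂M.drivingLaw ≤
      ENNReal.ofReal (M.survivalProb * x.1 k) := by
    intro k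
    simp_rw [ENNReal.ofReal_natCast]
    rw [ENNReal.ofReal_mul hρ.le, ENNReal.ofReal_natCast]
    exact M.lintegral_survivors_le x.1 k
  have hsint : ∀ k, Integrable (fun ω => (survivors x.1 ω k : ℝ)) M.drivingLaw := fun k => by
    refine ⟨(hsm k).aestronglyMeasurable, ?_⟩
    rw [hasFiniteIntegral_iff_ofReal (Eventually.of_forall fun ω => by positivity)]
    exact (hsb k).trans_lt ENNReal.ofReal_lt_top
  have hsle : ∀ k, ∫ ω, (survivors x.1 ω k : ℝ) ∂M.drivingLaw ≤ M.survivalProb * x.1 k := by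
    intro k
    rw [integral_eq_lintegral_of_nonneg_ae (Eventually.of_forall fun ω => by positivity)
      (hsm k).aestronglyMeasurable]
    exact ENNReal.toReal_le_of_le_ofReal (by positivity) (hsb k)
  obtain ⟨haint, hale⟩ := M.integral_abs_accrued_sub_le x.2
  have hpt : ∀ ω : Driving K, ∑ k, |(nextRewards x ω k : ℝ) - M.steadyRewards x.2 k| ≤
      ∑ k, (survivors x.1 ω k : ℝ) + |(accrued ω x.2 : ℝ) - M.lam x.2 / M.mu| := by
    intro ω
    have h1 : ∀ k, |(nextRewards x ω k : ℝ) - M.steadyRewards x.2 k| ≤ (survivors x.1 ω k : ℝ) +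
        if x.2 = k then |(accrued ω x.2 : ℝ) - M.lam x.2 / M.mu| else 0 := by
      intro k
      have h0 : (0 : ℝ) ≤ survivors x.1 ω k := by positivity
      unfold nextRewards steadyRewards
      split_ifs with hk
      · subst hk
        push_cast
        rw [add_sub_assoc]
        exact (abs_add_le _ _).trans_eq (by rw [abs_of_nonneg h0])
      · simp
    refine (Finset.sum_le_sum fun k _ => h1 k).trans_eq ?_
    rw [Finset.sum_add_distrib]
    simp
  have hbint : Integrable (fun ω => ∑ k, (survivors x.1 ω k : ℝ) +
      |(accrued ω x.2 : ℝ) - M.lam x.2 / M.mu|) M.drivingLaw :=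
    (integrable_finsetSum _ fun k _ => hsint k).add haint
  have hint := M.integrable_matchProb x i
  rw [measureReal_step_snd]
  have h2 : ∫ ω, matchProb M.alpha (fun k => (nextRewards x ω k : ℝ)) i ∂M.drivingLaw -
      matchProb M.alpha (M.steadyRewards x.2) i =
      ∫ ω, (matchProb M.alpha (fun k => (nextRewards x ω k : ℝ)) i -
        matchProb M.alpha (M.steadyRewards x.2) i) ∂M.drivingLaw := by
    rw [integral_sub hint (integrable_const _)]
    simp
  rw [h2]
  calc |∫ ω, (matchProb M.alpha (fun k => (nextRewards x ω k : ℝ)) i -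
        matchProb M.alpha (M.steadyRewards x.2) i) ∂M.drivingLaw|
      ≤ ∫ ω, |matchProb M.alpha (fun k => (nextRewards x ω k : ℝ)) i -
        matchProb M.alpha (M.steadyRewards x.2) i| ∂M.drivingLaw := abs_integral_le_integral_abs
    _ ≤ ∫ ω, 2 / M.alpha * (∑ k, (survivors x.1 ω k : ℝ) +
          |(accrued ω x.2 : ℝ) - M.lam x.2 / M.mu|) ∂M.drivingLaw := by
        refine integral_mono (hint.sub (integrable_const _)).abs (hbint.const_mul _) fun ω => ?_
        refine (abs_matchProb_sub_le hα _ _ i).trans ?_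
        gcongr
        exact hpt ω
    _ = 2 / M.alpha * (∑ k, ∫ ω, (survivors x.1 ω k : ℝ) ∂M.drivingLaw +
          ∫ ω, |(accrued ω x.2 : ℝ) - M.lam x.2 / M.mu| ∂M.drivingLaw) := by
        rw [integral_const_mul, integral_add (integrable_finsetSum _ fun k _ => hsint k) haint,
          integral_finsetSum _ fun k _ => hsint k]
    _ ≤ _ := by
        gcongr
        refine (Finset.sum_le_sum fun k _ => hsle k).trans_eq ?_
        rw [← Finset.mul_sum]
        simp [totalRewards]

variable (π : Measure (RewardState K))

/-- The probability of the choices `k` and `i` at time `0` and at the first update point. -/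
noncomputable def jointChoice (k i : Fin K) : ℝ :=
  (M.startedFrom π).real {p | p.1.2 = k ∧ (M.step p.1 p.2).2 = i}

theorem measurableSet_step_snd_uncurry (k i : Fin K) :
    MeasurableSet {p : RewardState K × Driving K | p.1.2 = k ∧ (M.step p.1 p.2).2 = i} :=
  ((measurable_snd.comp measurable_fst) (measurableSet_singleton k)).inter
    ((measurable_snd.comp M.measurable_step_uncurry) (measurableSet_singleton i))

theorem jointChoice_eq [IsProbabilityMeasure π] (k i : Fin K) :
    M.jointChoice π k i =
      ∫ x in {x | x.2 = k}, M.drivingLaw.real {ω | (M.step x ω).2 = i} ∂π := by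
  have hs := M.measurableSet_step_snd_uncurry k i
  have hk : MeasurableSet {x : RewardState K | x.2 = k} :=
    measurable_snd (measurableSet_singleton k)
  rw [jointChoice, measureReal_def, startedFrom, Measure.prod_apply hs,
    integral_eq_lintegral_of_nonneg_ae (Eventually.of_forall fun x => measureReal_nonneg)
      (measurable_of_countable _).aestronglyMeasurable, ← lintegral_indicator hk]
  congr 1
  refine lintegral_congr fun x => ?_
  by_cases hx : x.2 = k
  · rw [Set.indicator_of_mem (by exact hx), ofReal_measureReal]
    congr 1
    ext ω
    simp [hx]
  · rw [Set.indicator_of_notMem (by exact hx)]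
    simp [hx]

variable {π}

/-- In stationarity the second of two consecutive choices has the stationary law. -/
theorem IsStationary.sum_jointChoice (hπ : M.IsStationary π) (i : Fin K) :
    ∑ k, M.jointChoice π k i = π.real {x | x.2 = i} := by
  obtain ⟨h1, h2⟩ := (M.isStationary_iff π).mp hπ
  have hi : MeasurableSet {x : RewardState K | x.2 = i} :=
    measurable_snd (measurableSet_singleton i)
  have : IsProbabilityMeasure (M.startedFrom π) := by unfold startedFrom; infer_instance
  have h3 : π.real {x | x.2 = i} = (M.startedFrom π).real {p | (M.step p.1 p.2).2 = i} := by
    conv_lhs => rw [← h2.def, ← map_step_eq_bind]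
    rw [measureReal_def, Measure.map_apply M.measurable_step_uncurry hi]
    rfl
  have hT : MeasurableSet {p : RewardState K × Driving K | (M.step p.1 p.2).2 = i} :=
    (measurable_snd.comp M.measurable_step_uncurry) (measurableSet_singleton i)
  have hf : Measurable fun p : RewardState K × Driving K => p.1.2 :=
    measurable_snd.comp measurable_fst
  have h4 := sum_measureReal_preimage_singleton (f := fun p : RewardState K × Driving K => p.1.2)
    (μ := (M.startedFrom π).restrict {p | (M.step p.1 p.2).2 = i}) Finset.univ
    (fun k _ => hf (measurableSet_singleton k))
  rw [Finset.coe_univ, Set.preimage_univ, measureReal_restrict_apply MeasurableSet.univ,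
    Set.univ_inter] at h4
  rw [h3, ← h4]
  refine Finset.sum_congr rfl fun k _ => ?_
  rw [measureReal_restrict_apply (hf (measurableSet_singleton k))]
  rfl

theorem IsStationary.choiceTransition_eq (hπ : M.IsStationary π) (k i : Fin K) :
    M.choiceTransition π k i = M.jointChoice π k i / π.real {x | x.2 = k} := by
  obtain ⟨h1, h2⟩ := (M.isStationary_iff π).mp hπ
  have hk : MeasurableSet {x : RewardState K | x.2 = k} :=
    measurable_snd (measurableSet_singleton k)
  have hae := M.ae_embedded_eq π
  have e1 : ({p | (M.embedded p.1 p.2 0).2 = k} : Set (RewardState K × Driving K))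
      =ᵐ[M.startedFrom π] {p | p.1.2 = k} := by
    filter_upwards [hae] with p hp
    exact propext (by
      change (M.embedded p.1 p.2 0).2 = k ↔ p.1.2 = k
      rw [hp.2])
  have e2 : ({p | (M.embedded p.1 p.2 1).2 = i} : Set (RewardState K × Driving K))
      =ᵐ[(M.startedFrom π).restrict {p | p.1.2 = k}] {p | (M.step p.1 p.2).2 = i} := by
    filter_upwards [ae_restrict_of_ae hae] with p hp
    exact propext (by
      change (M.embedded p.1 p.2 1).2 = i ↔ (M.step p.1 p.2).2 = i
      rw [hp.1])
  have e3 : M.startedFrom π {p | p.1.2 = k} = π {x | x.2 = k} :=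
    (measurePreserving_fst (μ := π) (ν := M.drivingLaw)).measure_preimage hk.nullMeasurableSet
  have hs : MeasurableSet {p : RewardState K × Driving K | p.1.2 = k} :=
    (measurable_snd.comp measurable_fst) (measurableSet_singleton k)
  unfold choiceTransition
  rw [measureReal_def, ProbabilityTheory.cond, measure_congr e1, Measure.restrict_congr_set e1,
    Measure.smul_apply, measure_congr e2, e3, Measure.restrict_apply' hs, Set.inter_comm,
    smul_eq_mul, ENNReal.toReal_mul, ENNReal.toReal_inv, jointChoice, measureReal_def, measureReal_def,
    div_eq_inv_mul]
  rfl

/-- The choice chain in stationarity is nearly Markov, with the transition probabilities of the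
limiting chain. -/
theorem IsStationary.abs_jointChoice_sub_le (hπ : M.IsStationary π) (k i : Fin K) :
    |M.jointChoice π k i - π.real {x | x.2 = k} * matchProb M.alpha (M.steadyRewards k) i| ≤
      2 / M.alpha * (M.survivalProb * ((∑ k, M.lam k) / M.mu / (1 - M.survivalProb)) +
        √(M.lam k / M.mu + 2 * (M.lam k / M.mu) ^ 2 * M.survivalProb)) := by
  obtain ⟨h1, h2⟩ := (M.isStationary_iff π).mp hπ
  obtain ⟨hVint, hV⟩ := hπ.integral_totalRewards_le
  have hα := M.alpha_pos
  have hρ := M.survivalProb_pos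
  have hk : MeasurableSet {x : RewardState K | x.2 = k} :=
    measurable_snd (measurableSet_singleton k)
  set s := √(M.lam k / M.mu + 2 * (M.lam k / M.mu) ^ 2 * M.survivalProb) with hs
  have hs0 : 0 ≤ s := Real.sqrt_nonneg _
  have hint : Integrable (fun x => M.drivingLaw.real {ω | (M.step x ω).2 = i}) π := by
    refine Integrable.of_bound (C := 1) (measurable_of_countable _).aestronglyMeasurable
      (Eventually.of_forall fun x => ?_)
    rw [Real.norm_eq_abs, abs_of_nonneg measureReal_nonneg]
    exact measureReal_le_one
  have hbint : Integrable (fun x => 2 / M.alpha * (M.survivalProb * totalRewards x + s)) π :=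
    ((hVint.const_mul _).add (integrable_const _)).const_mul _
  have h3 : M.jointChoice π k i - π.real {x | x.2 = k} * matchProb M.alpha (M.steadyRewards k) i =
      ∫ x in {x | x.2 = k}, (M.drivingLaw.real {ω | (M.step x ω).2 = i} -
        matchProb M.alpha (M.steadyRewards k) i) ∂π := by
    rw [integral_sub hint.integrableOn (integrable_const _), jointChoice_eq, setIntegral_const,
      smul_eq_mul]
  rw [h3]
  calc |∫ x in {x | x.2 = k}, (M.drivingLaw.real {ω | (M.step x ω).2 = i} -
        matchProb M.alpha (M.steadyRewards k) i) ∂π|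
      ≤ ∫ x in {x | x.2 = k}, |M.drivingLaw.real {ω | (M.step x ω).2 = i} -
        matchProb M.alpha (M.steadyRewards k) i| ∂π := abs_integral_le_integral_abs
    _ ≤ ∫ x in {x | x.2 = k}, 2 / M.alpha * (M.survivalProb * totalRewards x + s) ∂π := by
        refine setIntegral_mono_on (hint.sub (integrable_const _)).abs.integrableOn
          hbint.integrableOn hk fun x hx => ?_
        have h4 := M.abs_measureReal_step_snd_sub_le x i
        have hx' : x.2 = k := hx
        rwa [hx'] at h4
    _ ≤ ∫ x, 2 / M.alpha * (M.survivalProb * totalRewards x + s) ∂π :=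
        setIntegral_le_integral hbint (Eventually.of_forall fun x => by
          change 0 ≤ 2 / M.alpha * (M.survivalProb * totalRewards x + s)
          positivity)
    _ = 2 / M.alpha * (M.survivalProb * ∫ x, (totalRewards x : ℝ) ∂π + s) := by
        rw [integral_const_mul, integral_add (hVint.const_mul _) (integrable_const _),
          integral_const_mul]
        simp
    _ ≤ _ := by gcongr

end RewardModel

/-! ### The limiting chain -/

section LimitChain

variable {K : ℕ} [NeZero K] {lam : Fin K → ℝ} {alpha0 : ℝ}

theorem limitChain_eq_matchProb {K : ℕ} (lam : Fin K → ℝ) (alpha0 : ℝ) (k i : Fin K) :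
    limitChain lam alpha0 k i = matchProb alpha0 (fun j => if k = j then lam k else 0) i := rfl

theorem limitChain_pos (halpha : 0 < alpha0) (k i : Fin K) : 0 < limitChain lam alpha0 k i :=
  div_pos (lt_max_of_lt_right halpha) (sum_max_pos halpha _)

/-- The total weight of row `k` of the limiting chain. -/
noncomputable def rowWeight {K : ℕ} (lam : Fin K → ℝ) (alpha0 : ℝ) (k : Fin K) : ℝ :=
  max (lam k) alpha0 + ((K : ℝ) - 1) * alpha0

theorem weight_eq {K : ℕ} {lam : Fin K → ℝ} (halpha : 0 < alpha0) (k j : Fin K) :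
    max (if k = j then lam k else 0) alpha0 =
      alpha0 + if k = j then max (lam k) alpha0 - alpha0 else 0 := by
  split_ifs
  · ring
  · rw [max_eq_right halpha.le, add_zero]

theorem sum_weight_eq {K : ℕ} {lam : Fin K → ℝ} (halpha : 0 < alpha0) (k : Fin K) :
    ∑ j, max (if k = j then lam k else 0) alpha0 = rowWeight lam alpha0 k := by
  simp_rw [weight_eq halpha]
  rw [Finset.sum_add_distrib]
  simp [rowWeight]
  ring

theorem rowWeight_pos (halpha : 0 < alpha0) (k : Fin K) : 0 < rowWeight lam alpha0 k := by
  rw [← sum_weight_eq halpha]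
  exact sum_max_pos halpha _

theorem limitProb_eq {K : ℕ} (lam : Fin K → ℝ) (alpha0 : ℝ) (k : Fin K) :
    limitProb lam alpha0 k = rowWeight lam alpha0 k / ∑ i, rowWeight lam alpha0 i := rfl

theorem limitChain_apply {K : ℕ} {lam : Fin K → ℝ} (halpha : 0 < alpha0) (k i : Fin K) :
    limitChain lam alpha0 k i =
      (alpha0 + if k = i then max (lam k) alpha0 - alpha0 else 0) / rowWeight lam alpha0 k := by
  rw [← weight_eq halpha, ← sum_weight_eq halpha]
  rfl

theorem sum_rowWeight_pos (halpha : 0 < alpha0) : 0 < ∑ i, rowWeight lam alpha0 i :=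
  Finset.sum_pos (fun i _ => rowWeight_pos halpha i) Finset.univ_nonempty

theorem limitProb_pos (halpha : 0 < alpha0) (k : Fin K) : 0 < limitProb lam alpha0 k :=
  div_pos (rowWeight_pos halpha k) (sum_rowWeight_pos halpha)

theorem sum_limitProb (halpha : 0 < alpha0) : ∑ k, limitProb lam alpha0 k = 1 := by
  simp_rw [limitProb_eq]
  rw [← Finset.sum_div, div_self (sum_rowWeight_pos halpha).ne']

theorem sum_limitChain (halpha : 0 < alpha0) (k : Fin K) : ∑ i, limitChain lam alpha0 k i = 1 := by
  refine (Finset.sum_congr rfl fun i _ => limitChain_eq_matchProb lam alpha0 k i).trans ?_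
  unfold matchProb
  rw [← Finset.sum_div, div_self (sum_max_pos halpha _).ne']

/-- The balance equations of the limiting chain solved with a defect: if `p` sums to `1` and
`e = p - p R`, then `p` is the stationary vector plus a linear expression in `e`. In the variables
`y k = p k / rowWeight k` the equations read `K * alpha0 * y i - alpha0 * ∑ k, y k = e i`. -/
theorem eq_limitProb_add (halpha : 0 < alpha0) {p : Fin K → ℝ} (hp : ∑ k, p k = 1) (i : Fin K) :
    p i = limitProb lam alpha0 i + rowWeight lam alpha0 i / (K * alpha0) *
      ((p i - ∑ k, p k * limitChain lam alpha0 k i) -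
        (∑ j, rowWeight lam alpha0 j * (p j - ∑ k, p k * limitChain lam alpha0 k j)) /
          ∑ j, rowWeight lam alpha0 j) := by
  have hK : (0 : ℝ) < K := by exact_mod_cast Nat.pos_of_ne_zero (NeZero.ne K)
  set D := rowWeight lam alpha0 with hD
  have hDpos : ∀ k, 0 < D k := fun k => rowWeight_pos halpha k
  set z := ∑ j, D j with hz
  have hzpos : 0 < z := sum_rowWeight_pos halpha
  set Y := ∑ k, p k / D k with hY
  set e : Fin K → ℝ := fun j => p j - ∑ k, p k * limitChain lam alpha0 k j with he
  have hbal : ∀ j, p j = D j / (K * alpha0) * (e j + alpha0 * Y) := by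
    intro j
    have h1 : ∑ k, p k * limitChain lam alpha0 k j =
        alpha0 * Y + p j / D j * (max (lam j) alpha0 - alpha0) := by
      simp_rw [limitChain_apply halpha, add_div, mul_add]
      rw [Finset.sum_add_distrib, hY, Finset.mul_sum]
      congr 1
      · exact Finset.sum_congr rfl fun k _ => by rw [← hD]; ring
      · rw [Finset.sum_eq_single j]
        · rw [if_pos rfl, ← hD]; ring
        · intro k _ hk
          rw [if_neg hk]; simp
        · simp
    have h2 : max (lam j) alpha0 - alpha0 = D j - K * alpha0 := by
      rw [hD, rowWeight]; ring
    have h3 : e j = p j - (alpha0 * Y + p j / D j * (D j - K * alpha0)) := by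
      rw [he, ← h2, ← h1]
    have h4 := (hDpos j).ne'
    rw [h3]
    field_simp
    ring
  have hsum : 1 = (∑ j, D j * e j) / (K * alpha0) + z * Y / K := by
    calc (1 : ℝ) = ∑ j, D j / (K * alpha0) * (e j + alpha0 * Y) := by
          rw [← hp]; exact Finset.sum_congr rfl fun j _ => hbal j
      _ = ∑ j, (D j * e j / (K * alpha0) + D j * Y / K) :=
          Finset.sum_congr rfl fun j _ => by field_simp
      _ = _ := by
          rw [Finset.sum_add_distrib, ← Finset.sum_div, ← Finset.sum_div, ← Finset.sum_mul]
  have hYeq : Y = (K - (∑ j, D j * e j) / alpha0) / z := by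
    rw [eq_div_iff hzpos.ne']
    field_simp at hsum ⊢
    linarith
  change p i = D i / z + D i / (K * alpha0) * (e i - (∑ j, D j * e j) / z)
  rw [hbal i, hYeq]
  field_simp
  ring

theorem limitProb_vecMul (halpha : 0 < alpha0) :
    Matrix.vecMul (limitProb lam alpha0) (limitChain lam alpha0) = limitProb lam alpha0 := by
  funext i
  change ∑ k, limitProb lam alpha0 k * limitChain lam alpha0 k i = _
  have h : ∀ k, limitProb lam alpha0 k * limitChain lam alpha0 k i =
      (alpha0 + if k = i then max (lam k) alpha0 - alpha0 else 0) /
        ∑ j, rowWeight lam alpha0 j := by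
    intro k
    rw [limitProb_eq, limitChain_apply halpha]
    have := (rowWeight_pos (lam := lam) halpha k).ne'
    have := (sum_rowWeight_pos (lam := lam) halpha).ne'
    field_simp
  rw [Finset.sum_congr rfl fun k _ => h k, ← Finset.sum_div, Finset.sum_add_distrib, limitProb_eq]
  simp [rowWeight]
  ring

theorem eq_limitProb_of_vecMul_eq (halpha : 0 < alpha0) {y : Fin K → ℝ} (hy : ∑ k, y k = 1)
    (h : Matrix.vecMul y (limitChain lam alpha0) = y) : y = limitProb lam alpha0 := by
  funext i
  have h0 : ∀ j, y j - ∑ k, y k * limitChain lam alpha0 k j = 0 := fun j =>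
    sub_eq_zero.mpr (congrFun h j).symm
  refine (eq_limitProb_add (lam := lam) halpha hy i).trans ?_
  rw [h0 i, Finset.sum_eq_zero fun j _ => by rw [h0 j, mul_zero]]
  ring

theorem limitChain_isIrreducible (halpha : 0 < alpha0) : (limitChain lam alpha0).IsIrreducible :=
  Matrix.IsPrimitive.isIrreducible ⟨fun k i => (limitChain_pos halpha k i).le, 1, one_pos,
    fun k i => by rw [pow_one]; exact limitChain_pos halpha k i⟩

theorem limitChain_mem_rowStochastic (halpha : 0 < alpha0) :
    limitChain lam alpha0 ∈ Matrix.rowStochastic ℝ (Fin K) :=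
  Matrix.mem_rowStochastic_iff_sum.mpr
    ⟨fun k i => (limitChain_pos halpha k i).le, fun k => sum_limitChain halpha k⟩

/-- Approximately stationary probability vectors converge to the stationary one. -/
theorem tendsto_limitProb (halpha : 0 < alpha0) {ι : Type*} {l : Filter ι} {p : ι → Fin K → ℝ}
    (hp : ∀ m, ∑ k, p m k = 1)
    (h : ∀ i, Tendsto (fun m => p m i - ∑ k, p m k * limitChain lam alpha0 k i) l (𝓝 0))
    (i : Fin K) : Tendsto (fun m => p m i) l (𝓝 (limitProb lam alpha0 i)) := by
  have h1 : Tendsto (fun m => limitProb lam alpha0 i + rowWeight lam alpha0 i / (K * alpha0) *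
      ((p m i - ∑ k, p m k * limitChain lam alpha0 k i) -
        (∑ j, rowWeight lam alpha0 j * (p m j - ∑ k, p m k * limitChain lam alpha0 k j)) /
          ∑ j, rowWeight lam alpha0 j)) l
      (𝓝 (limitProb lam alpha0 i + rowWeight lam alpha0 i / (K * alpha0) *
        (0 - (∑ j, rowWeight lam alpha0 j * 0) / ∑ j, rowWeight lam alpha0 j))) :=
    tendsto_const_nhds.add (((h i).sub ((tendsto_finsetSum _ fun j _ =>
      (h j).const_mul _).div_const _)).const_mul _)
  simp only [mul_zero, Finset.sum_const_zero, zero_div, sub_zero, add_zero] at h1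
  exact h1.congr fun m => (eq_limitProb_add halpha (hp m) i).symm

end LimitChain

/-! ### The scaling limit -/

namespace RewardModel

variable {K : ℕ} [NeZero K] {lam : Fin K → ℝ} {hlam : ∀ k, 0 < lam k} {alpha0 : ℝ}
  {halpha : 0 < alpha0} {beta : ℕ+ → ℝ} {hbeta : ∀ m, 0 < beta m}

theorem matchProb_scaled {K : ℕ} {lam : Fin K → ℝ} {hlam : ∀ k, 0 < lam k} (m : ℕ+) (k i : Fin K) :
    matchProb (scaled lam hlam alpha0 halpha beta hbeta m).alpha
      ((scaled lam hlam alpha0 halpha beta hbeta m).steadyRewards k) i =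
        limitChain lam alpha0 k i := by
  have hm : (0 : ℝ) < m := Nat.cast_pos.mpr m.pos
  have h : ∀ j, max ((scaled lam hlam alpha0 halpha beta hbeta m).steadyRewards k j)
      (scaled lam hlam alpha0 halpha beta hbeta m).alpha =
        max (if k = j then lam k else 0) alpha0 * m := by
    intro j
    rw [max_mul_of_nonneg _ _ hm.le]
    congr 1
    simp only [steadyRewards, scaled, one_div, div_inv_eq_mul]
    split_ifs <;> simp
  rw [limitChain_eq_matchProb, matchProb, matchProb]
  simp_rw [h]
  rw [← Finset.sum_mul, mul_div_mul_right _ _ hm.ne']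

/-- The joint law of consecutive choices in stationarity approaches that of the limiting chain. -/
theorem tendsto_jointChoice_sub
    (hslow : Tendsto (fun m : ℕ+ => (m : ℝ) * beta m) atTop (𝓝 0))
    {π : ℕ+ → Measure (RewardState K)}
    (hπ : ∀ m, (scaled lam hlam alpha0 halpha beta hbeta m).IsStationary (π m)) (k i : Fin K) :
    Tendsto (fun m => (scaled lam hlam alpha0 halpha beta hbeta m).jointChoice (π m) k i -
      (π m).real {x | x.2 = k} * limitChain lam alpha0 k i) atTop (𝓝 0) := by
  set L := ∑ k, lam k with hL
  have hL0 : 0 ≤ L := Finset.sum_nonneg fun k _ => (hlam k).le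
  have hinv : Tendsto (fun m : ℕ+ => ((m : ℝ))⁻¹) atTop (𝓝 0) :=
    tendsto_inv_atTop_zero.comp (tendsto_natCast_atTop_atTop.comp tendsto_PNat_val_atTop_atTop)
  have hbound : Tendsto (fun m : ℕ+ => 2 / alpha0 * (L * (m * beta m) +
      √(lam k * (m : ℝ)⁻¹ + 2 * lam k ^ 2 * (m * beta m)))) atTop (𝓝 0) := by
    have h1 : Tendsto (fun m : ℕ+ => 2 / alpha0 * (L * (m * beta m) +
        √(lam k * (m : ℝ)⁻¹ + 2 * lam k ^ 2 * (m * beta m)))) atTop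
        (𝓝 (2 / alpha0 * (L * 0 + √(lam k * 0 + 2 * lam k ^ 2 * 0)))) :=
      ((hslow.const_mul _).add ((hinv.const_mul _).add (hslow.const_mul _)).sqrt).const_mul _
    simpa using h1
  refine squeeze_zero_norm (fun m => ?_) hbound
  have hm : (0 : ℝ) < m := Nat.cast_pos.mpr m.pos
  have hb := hbeta m
  have hlk := hlam k
  have h2 := (hπ m).abs_jointChoice_sub_le _ k i
  rw [matchProb_scaled] at h2
  refine (Real.norm_eq_abs _).trans_le (h2.trans ?_)
  set M := scaled lam hlam alpha0 halpha beta hbeta m with hM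
  have hρ : M.survivalProb = m * beta m / (m * beta m + 1) := by
    simp only [survivalProb, hM, scaled]
    field_simp
  have hρ1 : 1 - M.survivalProb = 1 / (m * beta m + 1) := by
    rw [hρ]; field_simp; ring
  have hρle : M.survivalProb ≤ m * beta m := by
    rw [hρ]; exact div_le_self (by positivity) (by linarith [mul_pos hm hb])
  have hlam' : M.lam = lam := rfl
  have hmu : M.mu = 1 / (m : ℝ) := rfl
  have hal : M.alpha = alpha0 * m := rfl
  have h3 : M.survivalProb * ((∑ k, M.lam k) / M.mu / (1 - M.survivalProb)) =
      m * (L * (m * beta m)) := by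
    rw [hρ1, hρ, hlam', hmu, ← hL]
    field_simp
  have h4 : √(M.lam k / M.mu + 2 * (M.lam k / M.mu) ^ 2 * M.survivalProb) ≤
      m * √(lam k * (m : ℝ)⁻¹ + 2 * lam k ^ 2 * (m * beta m)) := by
    rw [hlam', hmu]
    refine Real.sqrt_le_iff.mpr ⟨by positivity, ?_⟩
    rw [mul_pow, Real.sq_sqrt (by positivity)]
    calc lam k / (1 / (m : ℝ)) + 2 * (lam k / (1 / (m : ℝ))) ^ 2 * M.survivalProb
        ≤ lam k / (1 / (m : ℝ)) + 2 * (lam k / (1 / (m : ℝ))) ^ 2 * (m * beta m) := by gcongr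
      _ = _ := by field_simp
  rw [h3, hal]
  calc 2 / (alpha0 * m) * (m * (L * (m * beta m)) +
        √(M.lam k / M.mu + 2 * (M.lam k / M.mu) ^ 2 * M.survivalProb))
      ≤ 2 / (alpha0 * m) * (m * (L * (m * beta m)) +
        m * √(lam k * (m : ℝ)⁻¹ + 2 * lam k ^ 2 * (m * beta m))) := by gcongr
    _ = _ := by field_simp

theorem IsStationary.sum_measureReal_choice {M : RewardModel K} {π : Measure (RewardState K)}
    (hπ : M.IsStationary π) : ∑ k, π.real {x | x.2 = k} = 1 := by
  have := hπ.isProbabilityMeasure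
  have h := sum_measureReal_preimage_singleton (μ := π) (f := fun x : RewardState K => x.2)
    Finset.univ (fun k _ => measurable_snd (measurableSet_singleton k))
  exact h.trans (by simp)

/-- The stationary choice probabilities are nearly stationary for the limiting chain, hence converge
to its stationary vector. -/
theorem tendsto_choice
    (hslow : Tendsto (fun m : ℕ+ => (m : ℝ) * beta m) atTop (𝓝 0))
    {π : ℕ+ → Measure (RewardState K)}
    (hπ : ∀ m, (scaled lam hlam alpha0 halpha beta hbeta m).IsStationary (π m)) (k : Fin K) :
    Tendsto (fun m => (π m).real {x | x.2 = k}) atTop (𝓝 (limitProb lam alpha0 k)) := by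
  refine tendsto_limitProb halpha (p := fun m k => (π m).real {x | x.2 = k})
    (fun m => (hπ m).sum_measureReal_choice) (fun i => ?_) k
  have h := tendsto_finsetSum Finset.univ fun k _ => tendsto_jointChoice_sub hslow hπ k i
  simp only [Finset.sum_const_zero] at h
  refine h.congr fun m => ?_
  rw [Finset.sum_sub_distrib, (hπ m).sum_jointChoice]

theorem tendsto_choiceTransition
    (hslow : Tendsto (fun m : ℕ+ => (m : ℝ) * beta m) atTop (𝓝 0))
    {π : ℕ+ → Measure (RewardState K)}
    (hπ : ∀ m, (scaled lam hlam alpha0 halpha beta hbeta m).IsStationary (π m)) (k i : Fin K) :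
    Tendsto (fun m => (scaled lam hlam alpha0 halpha beta hbeta m).choiceTransition (π m) k i)
      atTop (𝓝 (limitChain lam alpha0 k i)) := by
  have hp := tendsto_choice hslow hπ k
  have hpos : limitProb lam alpha0 k ≠ 0 := (limitProb_pos halpha k).ne'
  have h1 := ((tendsto_jointChoice_sub hslow hπ k i).add
    (hp.mul_const (limitChain lam alpha0 k i))).div hp hpos
  simp only [sub_add_cancel, zero_add] at h1
  rw [mul_div_cancel_left₀ _ hpos] at h1
  exact h1.congr fun m => ((hπ m).choiceTransition_eq _ k i).symm

end RewardModel

theorem mainTheorem7 {K : ℕ} [NeZero K] (lam : Fin K → ℝ) (hlam : ∀ k, 0 < lam k)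
    (alpha0 : ℝ) (halpha : 0 < alpha0) (beta : ℕ+ → ℝ) (hbeta : ∀ m, 0 < beta m)
    (hslow : beta =o[atTop] fun m : ℕ+ => 1 / (m : ℝ)) :
    -- each embedded chain has a unique stationary distribution
    (∀ m, ∃! π : Measure (RewardState K),
      (RewardModel.scaled lam hlam alpha0 halpha beta hbeta m).IsStationary π) ∧
    (∀ π : ℕ+ → Measure (RewardState K),
      (∀ m, (RewardModel.scaled lam hlam alpha0 halpha beta hbeta m).IsStationary (π m)) →
      -- the stationary choice probabilities converge
      (∀ k, Tendsto (fun m => (π m).real {w | w.2 = k}) atTop (𝓝 (limitProb lam alpha0 k))) ∧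
      -- the transition probabilities of the stationary choice chain converge
      (∀ k i, Tendsto
        (fun m => (RewardModel.scaled lam hlam alpha0 halpha beta hbeta m).choiceTransition
          (π m) k i)
        atTop (𝓝 (limitChain lam alpha0 k i)))) ∧
    -- the limit is the unique stationary vector of the limiting chain, which is irreducible
    limitChain lam alpha0 ∈ Matrix.rowStochastic ℝ (Fin K) ∧
    (limitChain lam alpha0).IsIrreducible ∧
    limitProb lam alpha0 ∈ stdSimplex ℝ (Fin K) ∧
    Matrix.vecMul (limitProb lam alpha0) (limitChain lam alpha0) = limitProb lam alpha0 ∧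
    (∀ y ∈ stdSimplex ℝ (Fin K),
      Matrix.vecMul y (limitChain lam alpha0) = y → y = limitProb lam alpha0) := by
  have hslow' : Tendsto (fun m : ℕ+ => (m : ℝ) * beta m) atTop (𝓝 0) := by
    refine hslow.tendsto_div_nhds_zero.congr fun m => ?_
    rw [div_div_eq_mul_div, div_one, mul_comm]
  exact ⟨fun m => RewardModel.existsUnique_isStationary _,
    fun π hπ => ⟨RewardModel.tendsto_choice hslow' hπ,
      RewardModel.tendsto_choiceTransition hslow' hπ⟩,
    limitChain_mem_rowStochastic halpha, limitChain_isIrreducible halpha,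
    ⟨fun k => (limitProb_pos halpha k).le, sum_limitProb halpha⟩, limitProb_vecMul halpha,
    fun y hy h => eq_limitProb_of_vecMul_eq halpha hy.2 h⟩
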